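/- Let $d\in\{1,2,3\}$, let $\Omega\subset\mathbb{R}^d$ be a bounded domain satisfying the interior cone condition (for instance a bounded Lipschitz domain), and let $T>0$, $\gamma>0$. Write $\langle\cdot,\cdot\rangle$ for the $L^2(\Omega)$ inner product, $\|\cdot\|_{0}$ and $\|\cdot\|_{0,\infty}$ for the norms of $L^2(\Omega)$ and $L^\infty(\Omega)$. Assume: * $b\in C^2(\mathbb{R})$ with $0<b_1\le b(s)\le b_2$, $|b'(s)|\le b_3$, $|b''(s)|\le b_4$ for all $s$; * $f\in C^4(\mathbb{R})$ with $f(s),f''(s)\ge -f_1$ for some $f_1\ge 0$, and $|f^{(k)}(s)|\le f_2^{(k)}+f_3^{(k)}|s|^{4-k}$ for $0\le k\le 4$ and all $s$, with constants $f_2^{(k)},f_3^{(k)}\ge 0$; $f$ has (local) minima at $s=\pm1$. Let $\phi\in L^\infty(0,T;H^1(\Omega))\cap L^2(0,T;H^2(\Omega))\cap H^1(0,T;L^2(\Omega))$ with $\phi\in[-1,1]$ a.e. and $\mu\in L^2(0,T;L^2(\Omega))$ be a weak solution of the Allen-Cahn problem, i.e. $$\langle\partial_t\phi,\psi\rangle+\langle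 b(\phi)\mu,\psi\rangle=0,\qquad \langle\mu,\xi\rangle-\langle\nabla\phi,\nabla\xi\rangle-\tfrac1\gamma\langle f'(\phi),\xi\rangle=0$$ for a.e. $t\in(0,T)$ and all $(\psi,\xi)\in L^2(\Omega)\times H^1(\Omega)$. Let $\hat\phi\in W^{1,\infty}(0,T;H^2(\Omega))$, $\hat\mu\in C^0(0,T;L^\infty(\Omega))$ and $r_1,r_2\in L^2(0,T;L^2(\Omega))$ satisfy $$\langle\partial_t\hat\phi,\psi\rangle+\langle b(\hat\phi)\hat\mu,\psi\rangle=\langle r_1,\psi\rangle,\qquad \langle\hat\mu,\xi\rangle-\langle\nabla\hat\phi,\nabla\xi\rangle-\tfrac1\gamma\langle f'(\hat\phi),\xi\rangle=\langle r_2,\xi\rangle$$ for a.e. $t\in(0,T)$ and all $(\psi,\xi)\in L^2(\Omega)\times H^1(\Omega)$. Define the relative energy and the relative dissipation by $$E(\phi|\hat\phi)=\tfrac12\|\nabla(\phi-\hat\phi)\|_0^2+\int_\Omega\tfrac1\gamma\big(f(\phi)-f(\hat\phi)-f'(\hat\phi)(\phi-\hat\phi)\big)\,\mathrm{d}x,\qquad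 D_\phi(\mu|\hat\mu)=\|b(\phi)^{1/2}(\mu-\hat\mu)\|_0^2 .$$ Then $\hat\phi(t),\partial_t\hat\phi(t)\in L^\infty(\Omega)$ for a.e. $t$, the function $t\mapsto E(\phi(t)|\hat\phi(t))$ coincides a.e. on $(0,T)$ with a function that is absolutely continuous on $[0,T]$, and the derivative of the latter satisfies, for a.e. $t\in(0,T)$, $$\frac{\mathrm{d}}{\mathrm{d}t}E(\phi|\hat\phi)+\tfrac12D_\phi(\mu|\hat\mu)\le\Big(\frac{C_1}{\gamma}\|\partial_t\hat\phi\|_{0,\infty}+C_4\|\hat\mu\|_{0,\infty}^2\Big)\|\phi-\hat\phi\|_0^2+C_2\|r_1\|_0^2+C_3\|r_2\|_0^2,$$ where $$C_1=f_2^{(3)}+f_3^{(3)}\big(1+\|\hat\phi\|_{0,\infty}\big),\quad C_2=\frac12+\frac3{b_1},\quad C_3=1+3b_2,\quad C_4=b_3^2+\frac{6b_3^2}{b_1}.$$ If $b_1\le 10$, the same estimate also holds with $C_4$ replaced by $b_3+\dfrac{6b_3^2}{b_1^2}$. -/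

import Mathlib

open MeasureTheory Set
open scoped ENNReal ContDiff

noncomputable section

namespace AllenCahn

/-- Euclidean space of dimension `d`. -/
abbrev Space (d : ℕ) := EuclideanSpace ℝ (Fin d)

variable {d : ℕ}

/-! ### Domains -/

/-- `Ω` satisfies the (interior) cone condition: there are a height `r > 0` and an opening
parameter `κ ∈ (0, 1)` such that every point of `Ω` is the vertex of an open truncated cone with
these parameters that lies in `Ω`. Every bounded Lipschitz domain has this property. -/
def ConeCondition (Ω : Set (Space d)) : Prop :=
  ∃ r : ℝ, 0 < r ∧ ∃ κ : ℝ, 0 < κ ∧ κ < 1 ∧ ∀ x ∈ Ω, ∃ v : Space d, ‖v‖ = 1 ∧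
    ∀ y : Space d, ‖y‖ < r → κ * ‖y‖ < inner ℝ y v → x + y ∈ Ω

/-- A bounded domain (open connected set) satisfying the cone condition. -/
structure IsRegularDomain (Ω : Set (Space d)) : Prop where
  isOpen : IsOpen Ω
  isConnected : IsConnected Ω
  isBounded : Bornology.IsBounded Ω
  cone : ConeCondition Ω

/-! ### Sobolev spaces on `Ω` -/

/-- `L²(Ω)`. -/
abbrev L2 (Ω : Set (Space d)) := Lp ℝ 2 (volume.restrict Ω)

/-- `L^∞(Ω)`. -/
abbrev LInf (Ω : Set (Space d)) := Lp ℝ ∞ (volume.restrict Ω)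

/-- `v` is the weak partial derivative `∂ᵢ u` on `Ω`. -/
def IsWeakDeriv (Ω : Set (Space d)) (i : Fin d) (u v : L2 Ω) : Prop :=
  ∀ η : Space d → ℝ, ContDiff ℝ ∞ η → HasCompactSupport η → tsupport η ⊆ Ω →
    ∫ x in Ω, u x * fderiv ℝ η x (EuclideanSpace.single i 1) = - ∫ x in Ω, v x * η x

theorem integrable_mul_test {Ω : Set (Space d)} (u : L2 Ω) {η : Space d → ℝ} (hη : Continuous η)
    (hc : HasCompactSupport η) : Integrable (fun x => u x * η x) (volume.restrict Ω) :=
  MemLp.integrable_mul (p := 2) (q := 2) (Lp.memLp u) (hη.memLp_of_hasCompactSupport hc)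

theorem continuous_fderiv_test {η : Space d → ℝ} (hη : ContDiff ℝ ∞ η) (e : Space d) :
    Continuous fun x => fderiv ℝ η x e :=
  (hη.continuous_fderiv (by simp)).clm_apply continuous_const

theorem isWeakDeriv_zero (Ω : Set (Space d)) (i : Fin d) : IsWeakDeriv Ω i 0 0 := by
  intro η _ _ _
  have h0 : ((0 : L2 Ω) : Space d → ℝ) =ᵐ[volume.restrict Ω] 0 := Lp.coeFn_zero _ _ _
  have key : ∀ ζ : Space d → ℝ, ∫ x in Ω, (0 : L2 Ω) x * ζ x = 0 := by
    intro ζ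
    refine integral_eq_zero_of_ae ?_
    filter_upwards [h0] with x hx
    rw [hx, Pi.zero_apply, zero_mul]
  rw [key, key, neg_zero]

theorem IsWeakDeriv.add {Ω : Set (Space d)} {i : Fin d} {u v u' v' : L2 Ω}
    (h : IsWeakDeriv Ω i u v) (h' : IsWeakDeriv Ω i u' v') :
    IsWeakDeriv Ω i (u + u') (v + v') := by
  intro η h1 h2 h3
  have key : ∀ (a b : L2 Ω) (ζ : Space d → ℝ), Continuous ζ → HasCompactSupport ζ →
      ∫ x in Ω, (a + b : L2 Ω) x * ζ x = (∫ x in Ω, a x * ζ x) + ∫ x in Ω, b x * ζ x := by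
    intro a b ζ hζ hc
    rw [← integral_add (integrable_mul_test a hζ hc) (integrable_mul_test b hζ hc)]
    refine integral_congr_ae ?_
    filter_upwards [Lp.coeFn_add a b] with x hx
    rw [hx, Pi.add_apply, add_mul]
  rw [key _ _ _ (continuous_fderiv_test h1 _) (h2.fderiv_apply (𝕜 := ℝ) _),
    key _ _ _ h1.continuous h2, h η h1 h2 h3, h' η h1 h2 h3, neg_add]

theorem IsWeakDeriv.smul {Ω : Set (Space d)} {i : Fin d} {u v : L2 Ω} (c : ℝ)
    (h : IsWeakDeriv Ω i u v) : IsWeakDeriv Ω i (c • u) (c • v) := by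
  intro η h1 h2 h3
  have key : ∀ (a : L2 Ω) (ζ : Space d → ℝ),
      ∫ x in Ω, (c • a : L2 Ω) x * ζ x = c * ∫ x in Ω, a x * ζ x := by
    intro a ζ
    rw [← integral_const_mul]
    refine integral_congr_ae ?_
    filter_upwards [Lp.coeFn_smul c a] with x hx
    rw [hx, Pi.smul_apply, smul_eq_mul, mul_assoc]
  rw [key, key, h η h1 h2 h3, mul_neg]

/-- The graph of the weak gradient in `L²(Ω) × L²(Ω)^d`. -/
def H1Graph (Ω : Set (Space d)) :
    Submodule ℝ (WithLp 2 (L2 Ω × PiLp 2 fun _ : Fin d => L2 Ω)) where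
  carrier := {p | ∀ i, IsWeakDeriv Ω i p.fst (p.snd i)}
  zero_mem' := fun i => isWeakDeriv_zero Ω i
  add_mem' := fun hp hq i => (hp i).add (hq i)
  smul_mem' := fun c _ hp i => (hp i).smul c

/-- The Sobolev space `H¹(Ω)`: a function `u ∈ L²(Ω)` together with its weak partial derivatives,
all in `L²(Ω)`. The norm is `(‖u‖² + ∑ᵢ ‖∂ᵢu‖²)^{1/2}`. -/
abbrev H1 (Ω : Set (Space d)) : Type := H1Graph Ω

/-- The underlying `L²` function. -/
def H1.toL2 {Ω : Set (Space d)} (u : H1 Ω) : L2 Ω := u.1.fst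

/-- The weak partial derivative `∂ᵢ u`. -/
def H1.grad {Ω : Set (Space d)} (u : H1 Ω) (i : Fin d) : L2 Ω := u.1.snd i

/-- The graph of the weak second derivatives in `H¹(Ω) × L²(Ω)^{d × d}`. -/
def H2Graph (Ω : Set (Space d)) :
    Submodule ℝ (WithLp 2 (H1 Ω × PiLp 2 fun _ : Fin d × Fin d => L2 Ω)) where
  carrier := {p | ∀ i j, IsWeakDeriv Ω j (p.fst.grad i) (p.snd (i, j))}
  zero_mem' := fun _ j => isWeakDeriv_zero Ω j
  add_mem' := fun hp hq i j => (hp i j).add (hq i j)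
  smul_mem' := fun c _ hp i j => (hp i j).smul c

/-- The Sobolev space `H²(Ω)`: a function `u ∈ H¹(Ω)` together with its weak second partial
derivatives `∂ⱼ∂ᵢu`, all in `L²(Ω)`. The norm is `(‖u‖² + ∑ᵢ ‖∂ᵢu‖² + ∑ᵢⱼ ‖∂ⱼ∂ᵢu‖²)^{1/2}`. -/
abbrev H2 (Ω : Set (Space d)) : Type := H2Graph Ω

/-- The underlying `H¹` function. -/
def H2.toH1 {Ω : Set (Space d)} (u : H2 Ω) : H1 Ω := u.1.fst

/-- The underlying `L²` function. -/
def H2.toL2 {Ω : Set (Space d)} (u : H2 Ω) : L2 Ω := u.toH1.toL2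

/-! ### Functions of time -/

/-- Lebesgue measure on the time interval `(0, T)`; the Bochner space `L^p(0,T;X)` consists of the
`u : ℝ → X` with `MemLp u p (timeMeasure T)`. -/
def timeMeasure (T : ℝ) : Measure ℝ := volume.restrict (Ioo 0 T)

/-- `u'` is the weak time derivative of `u` on `(0, T)`, as functions with values in `L²(Ω)`. -/
def HasWeakTimeDeriv {Ω : Set (Space d)} (T : ℝ) (u u' : ℝ → L2 Ω) : Prop :=
  ∀ η : ℝ → ℝ, ContDiff ℝ ∞ η → HasCompactSupport η → tsupport η ⊆ Ioo 0 T →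
    ∫ t, deriv η t • u t ∂(timeMeasure T) = - ∫ t, η t • u' t ∂(timeMeasure T)

/-- `φ ∈ L^∞(0,T;H¹(Ω)) ∩ L²(0,T;H²(Ω)) ∩ H¹(0,T;L²(Ω))`, with weak time derivative `φt`. -/
structure MemW {Ω : Set (Space d)} (T : ℝ) (φ : ℝ → H1 Ω) (φt : ℝ → L2 Ω) : Prop where
  memLp_H1 : MemLp φ ∞ (timeMeasure T)
  memLp_H2 : ∃ v : ℝ → H2 Ω, MemLp v 2 (timeMeasure T) ∧
    ∀ᵐ t ∂(timeMeasure T), (v t).toH1 = φ t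
  memLp_deriv : MemLp φt 2 (timeMeasure T)
  hasDeriv : HasWeakTimeDeriv T (fun t => (φ t).toL2) φt

/-- `φ ∈ W^{1,∞}(0,T;H²(Ω))`, with weak time derivative `φt`. -/
structure MemWhat {Ω : Set (Space d)} (T : ℝ) (φ φt : ℝ → H2 Ω) : Prop where
  memLp : MemLp φ ∞ (timeMeasure T)
  memLp_deriv : MemLp φt ∞ (timeMeasure T)
  hasDeriv : HasWeakTimeDeriv T (fun t => (φ t).toL2) (fun t => (φt t).toL2)

/-! ### The Allen-Cahn system -/

/-- Assumptions on the mobility `b` with the constants `b₁, …, b₄`. -/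
structure MobilityAssumption (b : ℝ → ℝ) (b₁ b₂ b₃ b₄ : ℝ) : Prop where
  contDiff : ContDiff ℝ 2 b
  pos : 0 < b₁
  lower : ∀ s, b₁ ≤ b s
  upper : ∀ s, b s ≤ b₂
  deriv_le : ∀ s, |deriv b s| ≤ b₃
  deriv2_le : ∀ s, |iteratedDeriv 2 b s| ≤ b₄

/-- Assumptions on the double-well potential `f` with the constants `f₁`, `f₂⁽ᵏ⁾ = f₂ k` and
`f₃⁽ᵏ⁾ = f₃ k` for `0 ≤ k ≤ 4`; `f` has minima at `-1` and `1`. -/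
structure PotentialAssumption (f : ℝ → ℝ) (f₁ : ℝ) (f₂ f₃ : ℕ → ℝ) : Prop where
  contDiff : ContDiff ℝ 4 f
  f₁_nonneg : 0 ≤ f₁
  lower : ∀ s, -f₁ ≤ f s
  deriv2_lower : ∀ s, -f₁ ≤ iteratedDeriv 2 f s
  f₂_nonneg : ∀ k ≤ 4, 0 ≤ f₂ k
  f₃_nonneg : ∀ k ≤ 4, 0 ≤ f₃ k
  growth : ∀ k ≤ 4, ∀ s, |iteratedDeriv k f s| ≤ f₂ k + f₃ k * |s| ^ (4 - k)
  min_neg_one : IsLocalMin f (-1)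
  min_one : IsLocalMin f 1

/-- The pair `(φ, μ)`, with `φt = ∂ₜφ`, is a weak solution of the Allen-Cahn problem on `[0, T]`. -/
structure IsWeakSolution (Ω : Set (Space d)) (T γ : ℝ) (b f : ℝ → ℝ)
    (φ : ℝ → H1 Ω) (φt μ : ℝ → L2 Ω) : Prop where
  range : ∀ᵐ t ∂(timeMeasure T), ∀ᵐ x ∂(volume.restrict Ω), (φ t).toL2 x ∈ Icc (-1 : ℝ) 1
  mem_phi : MemW T φ φt
  mem_mu : MemLp μ 2 (timeMeasure T)
  eq_phi : ∀ᵐ t ∂(timeMeasure T), ∀ ψ : L2 Ω,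
    (∫ x in Ω, φt t x * ψ x) + ∫ x in Ω, b ((φ t).toL2 x) * μ t x * ψ x = 0
  eq_mu : ∀ᵐ t ∂(timeMeasure T), ∀ ξ : H1 Ω,
    (∫ x in Ω, μ t x * ξ.toL2 x) - (∑ i, ∫ x in Ω, (φ t).grad i x * ξ.grad i x)
      - 1 / γ * ∫ x in Ω, deriv f ((φ t).toL2 x) * ξ.toL2 x = 0

/-- The pair `(φh, μh)`, with `φht = ∂ₜφh`, is a strong solution of the Allen-Cahn system perturbed
by the residuals `r₁, r₂`. -/
structure IsPerturbedSolution (Ω : Set (Space d)) (T γ : ℝ) (b f : ℝ → ℝ)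
    (φh φht : ℝ → H2 Ω) (μh : ℝ → LInf Ω) (r₁ r₂ : ℝ → L2 Ω) : Prop where
  mem_phi : MemWhat T φh φht
  mem_mu : ContinuousOn μh (Ioo 0 T)
  mem_r₁ : MemLp r₁ 2 (timeMeasure T)
  mem_r₂ : MemLp r₂ 2 (timeMeasure T)
  eq_phi : ∀ᵐ t ∂(timeMeasure T), ∀ ψ : L2 Ω,
    (∫ x in Ω, (φht t).toL2 x * ψ x) + ∫ x in Ω, b ((φh t).toL2 x) * μh t x * ψ x
      = ∫ x in Ω, r₁ t x * ψ x
  eq_mu : ∀ᵐ t ∂(timeMeasure T), ∀ ξ : H1 Ω,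
    (∫ x in Ω, μh t x * ξ.toL2 x) - (∑ i, ∫ x in Ω, (φh t).toH1.grad i x * ξ.grad i x)
      - 1 / γ * ∫ x in Ω, deriv f ((φh t).toL2 x) * ξ.toL2 x = ∫ x in Ω, r₂ t x * ξ.toL2 x

/-- The pointwise relative energy density `f(a|c) = f(a) - f(c) - f'(c)(a - c)`. -/
def relPotential (f : ℝ → ℝ) (a c : ℝ) : ℝ := f a - f c - deriv f c * (a - c)

/-- The relative energy `E(u|w) = ½ ‖∇(u - w)‖² + ∫ (1/γ) f(u|w)`. -/
def relEnergy {Ω : Set (Space d)} (γ : ℝ) (f : ℝ → ℝ) (u w : H1 Ω) : ℝ :=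
  1 / 2 * (∑ i, ‖u.grad i - w.grad i‖ ^ 2)
    + ∫ x in Ω, 1 / γ * relPotential f (u.toL2 x) (w.toL2 x)

/-- The relative dissipation `D_u(m|n) = ‖b(u)^{1/2} (m - n)‖²`. -/
def relDissipation {Ω : Set (Space d)} (b : ℝ → ℝ) (u m : L2 Ω) (n : LInf Ω) : ℝ :=
  ∫ x in Ω, (Real.sqrt (b (u x)) * (m x - n x)) ^ 2

/-- The `L^∞(Ω)` norm (meaningful for essentially bounded functions). -/
def supNorm {Ω : Set (Space d)} (u : L2 Ω) : ℝ := (eLpNorm u ∞ (volume.restrict Ω)).toReal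

end AllenCahn

end

/-! Write `w = φ - φh`, `G = μ - μh + r₂` and `R = f'(φ) - f'(φh) - f''(φh) w`. Subtracting the two
equations for the chemical potential shows that `G` represents the variational derivative: `⟪G, ξ⟫ =
⟪∇w, ∇ξ⟫ + (1/γ) ⟪f'(φ) - f'(φh), ξ⟫` for every `ξ` in `H¹`. Formally, therefore, `d/dt E = ⟪∂ₜw, G⟫
+ (1/γ) ⟪∂ₜφh, R⟫`. Testing the two evolution equations with `ψ = G` turns the first term into an
integral without time derivatives, and the claim becomes a pointwise inequality in `x`: a quadratic
in `μ - μh` is maximised by completing the square (`dissipation_estimate`), while `R` is bounded by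
the third derivative of `f` times `w ^ 2` (`abs_relPotential_deriv_le`). This is `rate_le`.

The analytic difficulty is the chain rule, since `∂ₜφ` is only in `L²` and `∇φ` need not have a time
derivative in `L²`. The remedy is to work with increments between two times. The polarisation `½‖x‖²
- ½‖y‖² = ½⟪x + y, x - y⟫` and the representation of `G` at both times, tested with the increment of
`w`, remove all gradients. The potential part is treated by a trapezoidal rule with quadratic error
(`abs_relPotential_trapezoid_le`). Together these give, in `abs_relEnergy_increment_le`, the
increment of `E` as a trapezoidal pairing of increments of `w` and `φh` with `G` and `R / γ`, up to
their squared `L²` norms. Integrating this over time with a shift `h`, dividing by `h` and letting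
`h` tend to zero yields the integrated chain rule, because translations are continuous in `L²`
(`exists_increment_eq_integral_of_estimate`). The rate is integrable in time, so its primitive is
the absolutely continuous representative.

The local bounds on `f` need `φh` in `L^∞`, that is, the embedding of `H²` for `d ≤ 3`. It is proved
directly from the cone condition (`exists_bound_of_weakDeriv`): the average of `u(x + ε z)` against
a bump `θ(z)` supported in the cone tends to `u(x)` as `ε → 0` for almost every `x`, and its second
derivative in `ε` is `O(ε ^ (-d/2))`, which is `O(ε ^ (-3/2))` and stays bounded after two
integrations. -/

noncomputable section

namespace AllenCahn

open Filter
open scoped Topology Convolution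

variable {d : ℕ}

/-! ### Weak time derivatives and increments -/

/-- If `V` is an integrable weak derivative of `F` on `(0, T)`, then the increments of `F` between
points of a set of full measure are the integrals of `V`. -/
theorem exists_increment_eq_integral {X : Type*} [NormedAddCommGroup X] [NormedSpace ℝ X]
    [CompleteSpace X] {T : ℝ} {F V : ℝ → X} (hF : IntegrableOn F (Ioo 0 T))
    (hV : IntegrableOn V (Ioo 0 T))
    (h : ∀ η : ℝ → ℝ, ContDiff ℝ ∞ η → HasCompactSupport η → tsupport η ⊆ Ioo 0 T →
      ∫ t in Ioo 0 T, deriv η t • F t = -∫ t in Ioo 0 T, η t • V t) :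
    ∃ S ⊆ Ioo 0 T, (∀ᵐ t ∂(volume.restrict (Ioo 0 T)), t ∈ S) ∧
      ∀ s ∈ S, ∀ t ∈ S, F t - F s = ∫ x in s..t, V x := by
  set F₀ : ℝ → X := (Ioo 0 T).indicator F with hF₀
  have hF₀i : Integrable F₀ := (integrable_indicator_iff measurableSet_Ioo).2 hF
  -- The radii shrink to zero with the fixed ratio 2, as almost everywhere convergence of the
  -- mollifications requires.
  let φ : ℕ → ContDiffBump (0 : ℝ) := fun n =>
    ⟨1 / ((n : ℝ) + 1), 2 * (1 / ((n : ℝ) + 1)), by positivity, by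
      have : (0 : ℝ) < 1 / ((n : ℝ) + 1) := by positivity
      linarith⟩
  have hφ : Tendsto (fun n => (φ n).rOut) atTop (𝓝 0) := by
    have := (tendsto_one_div_add_atTop_nhds_zero_nat (𝕜 := ℝ)).const_mul 2
    rw [mul_zero] at this
    exact this
  have hφ' : ∀ᶠ n in atTop, (φ n).rOut ≤ 2 * (φ n).rIn := Eventually.of_forall fun n => le_rfl
  set ρ : ℕ → ℝ → ℝ := fun n => (φ n).normed volume with hρ
  have hρc : ∀ n, ContDiff ℝ ∞ (ρ n) := fun n => (φ n).contDiff_normed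
  have hρi : ∀ n, Integrable (ρ n) := fun n => (φ n).integrable_normed
  have hρ1 : ∀ n, ∫ x, ρ n x = 1 := fun n => (φ n).integral_normed
  have hρ0 : ∀ n x, 0 ≤ ρ n x := fun n x => (φ n).nonneg_normed x
  have hρe : ∀ n x, ρ n (-x) = ρ n x := fun n x => (φ n).normed_neg x
  have hρs : ∀ n x, (φ n).rOut ≤ |x| → ρ n x = 0 := by
    intro n x hx
    by_contra hne
    have : x ∈ Function.support (ρ n) := hne
    rw [hρ, ContDiffBump.support_normed_eq] at this
    rw [Metric.mem_ball, dist_zero_right, Real.norm_eq_abs] at this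
    linarith
  have hconv := ContDiffBump.ae_convolution_tendsto_right_of_locallyIntegrable (μ := volume) hφ hφ'
    hF₀i.locallyIntegrable
  -- The full-measure set consists of the times at which the mollifications of `F` converge to `F`;
  -- it does not depend on a pair `s, t`.
  refine ⟨{t | t ∈ Ioo 0 T ∧ Tendsto (fun n => (ρ n ⋆[ContinuousLinearMap.lsmul ℝ ℝ, volume] F₀) t)
    atTop (𝓝 (F₀ t))}, fun t ht => ht.1, ?_, ?_⟩
  · filter_upwards [ae_restrict_of_ae hconv, ae_restrict_mem measurableSet_Ioo] with t h1 h2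
      using ⟨h2, h1⟩
  have key : ∀ s t, s ≤ t → s ∈ Ioo 0 T → t ∈ Ioo 0 T →
      Tendsto (fun n => (ρ n ⋆[ContinuousLinearMap.lsmul ℝ ℝ, volume] F₀) s) atTop (𝓝 (F₀ s)) →
      Tendsto (fun n => (ρ n ⋆[ContinuousLinearMap.lsmul ℝ ℝ, volume] F₀) t) atTop (𝓝 (F₀ t)) →
      F t - F s = ∫ x in s..t, V x := by
    intro s t hst hs ht hs' ht'
    -- The test function is the mollified indicator of `(s, t]`. Its derivative is a difference of
    -- two mollifiers, centred at `s` and at `t`, so testing `F` with it produces mollifications of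
    -- `F` at these two points.
    set η : ℕ → ℝ → ℝ := fun n τ => ∫ x in s..t, ρ n (τ - x) with hη
    have hηd : ∀ n τ, HasDerivAt (η n) (ρ n (τ - s) - ρ n (τ - t)) τ := by
      intro n τ
      have hc : Continuous (ρ n) := (hρc n).continuous
      have e : η n = fun τ => (∫ x in (0:ℝ)..(τ - s), ρ n x) - ∫ x in (0:ℝ)..(τ - t), ρ n x := by
        funext τ
        simp only [hη]
        rw [intervalIntegral.integral_comp_sub_left (fun x => ρ n x) τ]
        rw [intervalIntegral.integral_interval_sub_left (hc.intervalIntegrable _ _)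
          (hc.intervalIntegrable _ _)]
      rw [e]
      have h1 : ∀ a, HasDerivAt (fun τ : ℝ => ∫ x in (0:ℝ)..(τ - a), ρ n x) (ρ n (τ - a)) τ := by
        intro a
        have := (hc.integral_hasStrictDerivAt 0 (τ - a)).hasDerivAt
        exact this.comp_sub_const τ a
      exact (h1 s).sub (h1 t)
    have hηderiv : ∀ n, deriv (η n) = fun τ => ρ n (τ - s) - ρ n (τ - t) := fun n =>
      funext fun τ => (hηd n τ).deriv
    have hηc : ∀ n, ContDiff ℝ ∞ (η n) := by
      intro n
      rw [contDiff_infty_iff_deriv]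
      refine ⟨fun τ => (hηd n τ).differentiableAt, ?_⟩
      rw [hηderiv]
      exact ((hρc n).comp (contDiff_id.sub contDiff_const)).sub
        ((hρc n).comp (contDiff_id.sub contDiff_const))
    have hη0 : ∀ n τ, τ ∉ Icc (s - (φ n).rOut) (t + (φ n).rOut) → η n τ = 0 := by
      intro n τ hτ
      simp only [hη]
      refine (intervalIntegral.integral_congr (g := fun _ => (0:ℝ)) ?_).trans (by simp)
      intro x hx
      rw [uIcc_of_le hst] at hx
      refine hρs n _ ?_
      rw [mem_Icc, not_and_or, not_le, not_le] at hτ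
      rcases hτ with hτ | hτ
      · rw [abs_of_nonpos (by linarith [hx.1, (φ n).rOut_pos])]; linarith [hx.1]
      · rw [abs_of_nonneg (by linarith [hx.2, (φ n).rOut_pos])]; linarith [hx.2]
    have hηts : ∀ n, tsupport (η n) ⊆ Icc (s - (φ n).rOut) (t + (φ n).rOut) := by
      intro n
      refine closure_minimal ?_ isClosed_Icc
      intro τ hτ
      by_contra hne
      exact hτ (hη0 n τ hne)
    have hηcs : ∀ n, HasCompactSupport (η n) := fun n =>
      HasCompactSupport.of_support_subset_isCompact isCompact_Icc
        ((subset_tsupport _).trans (hηts n))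
    have hηconv : ∀ n τ, η n τ = (ρ n ⋆[ContinuousLinearMap.lsmul ℝ ℝ, volume]
        ((Ioc s t).indicator fun _ => (1:ℝ))) τ := by
      intro n τ
      rw [convolution_eq_swap]
      simp only [hη, intervalIntegral.integral_of_le hst]
      rw [← integral_indicator measurableSet_Ioc]
      congr 1
      funext x
      by_cases hx : x ∈ Ioc s t <;> simp [hx]
    have hηlim : ∀ᵐ τ, Tendsto (fun n => η n τ) atTop
        (𝓝 ((Ioc s t).indicator (fun _ => (1:ℝ)) τ)) := by
      have hi : Integrable ((Ioc s t).indicator fun _ => (1:ℝ)) :=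
        (integrable_indicator_iff measurableSet_Ioc).2 (by simp)
      filter_upwards [ContDiffBump.ae_convolution_tendsto_right_of_locallyIntegrable (μ := volume)
        hφ hφ' hi.locallyIntegrable] with τ hτ
      simpa only [hηconv] using hτ
    have hηle : ∀ n τ, ‖η n τ‖ ≤ 1 := by
      intro n τ
      simp only [hη]
      rw [intervalIntegral.integral_of_le hst,
        Real.norm_of_nonneg (integral_nonneg fun x => hρ0 _ _)]
      calc ∫ x in Ioc s t, ρ n (τ - x) ≤ ∫ x, ρ n (τ - x) :=
            setIntegral_le_integral ((hρi n).comp_sub_left τ) (ae_of_all _ fun x => hρ0 _ _)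
        _ = 1 := by rw [integral_sub_left_eq_self (ρ n) volume τ, hρ1]
    -- Since `s` and `t` are interior, the enlarged interval lies in `(0, T)` for large `n`, and
    -- only then is `η n` admissible.
    have hev : ∀ᶠ n in atTop, Icc (s - (φ n).rOut) (t + (φ n).rOut) ⊆ Ioo 0 T := by
      have h1 : ∀ᶠ n in atTop, (φ n).rOut < min s (T - t) :=
        hφ.eventually_lt_const (lt_min hs.1 (by linarith [ht.2]))
      filter_upwards [h1] with n hn x hx
      exact ⟨by linarith [hx.1, hn.trans_le (min_le_left _ _)],
        by linarith [hx.2, hn.trans_le (min_le_right _ _)]⟩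
    have hlhs : ∀ n, ∫ τ in Ioo 0 T, deriv (η n) τ • F τ =
        (ρ n ⋆[ContinuousLinearMap.lsmul ℝ ℝ, volume] F₀) s -
          (ρ n ⋆[ContinuousLinearMap.lsmul ℝ ℝ, volume] F₀) t := by
      intro n
      rw [convolution_eq_swap, convolution_eq_swap, ← integral_indicator measurableSet_Ioo]
      have hi : ∀ a, Integrable fun x => (ContinuousLinearMap.lsmul ℝ ℝ) (ρ n (a - x)) (F₀ x) := by
        intro a
        obtain ⟨B, hB⟩ := ((φ n).hasCompactSupport_normed (μ := volume)).exists_bound_of_continuous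
          (hρc n).continuous
        exact hF₀i.bdd_smul B
          (((hρc n).continuous.comp (continuous_const.sub continuous_id)).aestronglyMeasurable)
          (ae_of_all _ fun x => hB _)
      rw [← integral_sub (hi s) (hi t)]
      congr 1
      funext x
      by_cases hx : x ∈ Ioo 0 T
      · simp only [indicator_of_mem hx, hηderiv, hF₀, ContinuousLinearMap.lsmul_apply, sub_smul]
        rw [← hρe n (x - s), ← hρe n (x - t), neg_sub, neg_sub]
      · simp [indicator_of_notMem hx, hF₀]
    have hrhs : Tendsto (fun n => ∫ τ in Ioo 0 T, η n τ • V τ) atTop (𝓝 (∫ x in s..t, V x)) := by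
      have e : ∫ x in s..t, V x =
          ∫ τ in Ioo 0 T, (Ioc s t).indicator (fun _ => (1:ℝ)) τ • V τ := by
        rw [intervalIntegral.integral_of_le hst, ← integral_indicator measurableSet_Ioc,
          ← integral_indicator measurableSet_Ioo]
        congr 1
        funext x
        by_cases hx : x ∈ Ioc s t
        · have hx' : x ∈ Ioo 0 T := ⟨hs.1.trans hx.1, hx.2.trans_lt ht.2⟩
          simp [indicator_of_mem hx, indicator_of_mem hx']
        · by_cases hx' : x ∈ Ioo 0 T <;> simp [hx, hx']
      rw [e]
      refine tendsto_integral_of_dominated_convergence (fun τ => ‖V τ‖) ?_ hV.norm ?_ ?_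
      · exact fun n => (hηc n).continuous.aestronglyMeasurable.smul hV.aestronglyMeasurable
      · intro n
        refine ae_of_all _ fun τ => ?_
        rw [norm_smul]
        exact mul_le_of_le_one_left (norm_nonneg _) (hηle n τ)
      · filter_upwards [ae_restrict_of_ae hηlim] with τ hτ
        exact hτ.smul_const _
    have hl2 := hs'.sub ht'
    have heq : ∀ᶠ n in atTop, (ρ n ⋆[ContinuousLinearMap.lsmul ℝ ℝ, volume] F₀) s -
          (ρ n ⋆[ContinuousLinearMap.lsmul ℝ ℝ, volume] F₀) t =
          -∫ τ in Ioo 0 T, η n τ • V τ := by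
      filter_upwards [hev] with n hn
      rw [← hlhs, h (η n) (hηc n) (hηcs n) ((hηts n).trans hn)]
    have := tendsto_nhds_unique (hl2.congr' heq) hrhs.neg
    rw [hF₀, indicator_of_mem hs, indicator_of_mem ht] at this
    rw [← neg_sub, this, neg_neg]
  rintro s ⟨hs, hs'⟩ t ⟨ht, ht'⟩
  rcases le_total s t with hst | hst
  · exact key s t hst hs ht hs' ht'
  · rw [intervalIntegral.integral_symm, ← key t s hst ht hs ht' hs', neg_sub]

/-! ### Translations and short time windows in `L²(ℝ; X)` -/

section Translation

variable {X : Type*} [NormedAddCommGroup X]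

/-- Translation `V ↦ V (h + ·)` on `L²(ℝ; X)`. -/
def translate (h : ℝ) (V : Lp X 2 (volume : Measure ℝ)) : Lp X 2 (volume : Measure ℝ) :=
  DomAddAct.mk h +ᵥ V

theorem coeFn_translate (h : ℝ) (V : Lp X 2 (volume : Measure ℝ)) :
    translate h V =ᵐ[volume] fun τ => V (h + τ) :=
  DomAddAct.vadd_Lp_ae_eq _ _

theorem continuous_translate (V : Lp X 2 (volume : Measure ℝ)) :
    Continuous fun h => translate h V := by
  have : Fact ((2 : ℝ≥0∞) ≠ ⊤) := ⟨by simp⟩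
  exact (DomAddAct.continuous_mk).vadd continuous_const

theorem translate_zero (V : Lp X 2 (volume : Measure ℝ)) : translate 0 V = V := by
  refine Lp.ext ?_
  filter_upwards [coeFn_translate 0 V] with x hx
  rw [hx, zero_add]

theorem tendsto_translate (V : Lp X 2 (volume : Measure ℝ)) :
    Tendsto (fun h => translate h V) (𝓝 0) (𝓝 V) := by
  simpa only [translate_zero] using (continuous_translate V).tendsto 0

theorem integrable_norm_sq (V : Lp X 2 (volume : Measure ℝ)) :
    Integrable fun τ => ‖V τ‖ ^ 2 :=
  (memLp_two_iff_integrable_sq_norm (Lp.memLp V).1).1 (Lp.memLp V)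

variable [InnerProductSpace ℝ X]

/-- The `L²` pairing over a set `A` of times. -/
def setPairing (A : Set ℝ) (V K : Lp X 2 (volume : Measure ℝ)) : ℝ :=
  inner ℝ (LpToLpRestrictCLM ℝ X ℝ volume 2 A V) (LpToLpRestrictCLM ℝ X ℝ volume 2 A K)

theorem setPairing_eq (A : Set ℝ) (V K : Lp X 2 (volume : Measure ℝ)) :
    setPairing A V K = ∫ τ in A, inner ℝ (V τ) (K τ) := by
  rw [setPairing, L2.inner_def]
  refine integral_congr_ae ?_
  filter_upwards [LpToLpRestrictCLM_coeFn ℝ A V, LpToLpRestrictCLM_coeFn ℝ A K] with τ h1 h2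
  rw [h1, h2]

theorem tendsto_setPairing (A : Set ℝ) {α : Type*} {l : Filter α}
    {f g : α → Lp X 2 (volume : Measure ℝ)} {V K : Lp X 2 (volume : Measure ℝ)}
    (hf : Tendsto f l (𝓝 V)) (hg : Tendsto g l (𝓝 K)) :
    Tendsto (fun a => setPairing A (f a) (g a)) l (𝓝 (setPairing A V K)) := by
  have h1 := ((LpToLpRestrictCLM ℝ X ℝ volume 2 A).continuous.tendsto V).comp hf
  have h2 := ((LpToLpRestrictCLM ℝ X ℝ volume 2 A).continuous.tendsto K).comp hg
  exact h1.inner h2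

/-- This is the Fubini hypothesis. Young's inequality bounds each slice by `∫ ‖V‖² + ∫ ‖K‖²`,
uniformly in `σ` by translation invariance, and the window of `σ` has finite measure. -/
theorem integrable_translate_inner (A : Set ℝ) (a b : ℝ) (V K : Lp X 2 (volume : Measure ℝ)) :
    Integrable (Function.uncurry fun τ σ => inner ℝ (V (σ + τ)) (K τ))
      ((volume.restrict A).prod (volume.restrict (Ioc a b))) := by
  have hm : AEStronglyMeasurable (Function.uncurry fun τ σ : ℝ => inner ℝ (V (σ + τ)) (K τ))
      ((volume.restrict A).prod (volume.restrict (Ioc a b))) := by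
    refine StronglyMeasurable.aestronglyMeasurable ?_
    exact ((Lp.stronglyMeasurable V).comp_measurable (measurable_snd.add measurable_fst)).inner
      ((Lp.stronglyMeasurable K).comp_measurable measurable_fst)
  have hVσ : ∀ σ, Integrable fun τ => ‖V (σ + τ)‖ ^ 2 := fun σ =>
    (integrable_norm_sq V).comp_add_left σ
  have hle : ∀ σ τ, ‖(inner ℝ (V (σ + τ)) (K τ) : ℝ)‖ ≤ ‖V (σ + τ)‖ ^ 2 + ‖K τ‖ ^ 2 := by
    intro σ τ
    refine (norm_inner_le_norm _ _).trans ?_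
    nlinarith [sq_nonneg (‖V (σ + τ)‖ - ‖K τ‖), sq_nonneg ‖V (σ + τ)‖, sq_nonneg ‖K τ‖]
  have hσ : ∀ σ, Integrable (fun τ => (inner ℝ (V (σ + τ)) (K τ) : ℝ)) (volume.restrict A) := by
    intro σ
    refine (((hVσ σ).add (integrable_norm_sq K)).restrict).mono' ?_ (ae_of_all _ (hle σ))
    exact (((Lp.stronglyMeasurable V).comp_measurable (measurable_const.add measurable_id)).inner
      (Lp.stronglyMeasurable K)).aestronglyMeasurable
  rw [integrable_prod_iff' hm]
  refine ⟨ae_of_all _ hσ, ?_⟩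
  have hm' := hm.norm.prod_swap.integral_prod_right'
  refine Integrable.mono' (g := fun _ => (∫ τ, ‖V τ‖ ^ 2) + ∫ τ, ‖K τ‖ ^ 2)
    (integrable_const _) hm' (ae_of_all _ fun σ => ?_)
  rw [Real.norm_of_nonneg (integral_nonneg fun τ => norm_nonneg _)]
  calc ∫ τ in A, ‖(inner ℝ (V (σ + τ)) (K τ) : ℝ)‖
      ≤ ∫ τ in A, (‖V (σ + τ)‖ ^ 2 + ‖K τ‖ ^ 2) :=
        integral_mono (hσ σ).norm ((hVσ σ).add (integrable_norm_sq K)).restrict (hle σ)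
    _ ≤ ∫ τ, (‖V (σ + τ)‖ ^ 2 + ‖K τ‖ ^ 2) :=
        setIntegral_le_integral ((hVσ σ).add (integrable_norm_sq K))
          (ae_of_all _ fun τ => by positivity)
    _ = _ := by
        rw [integral_add (hVσ σ) (integrable_norm_sq K),
          integral_add_left_eq_self (fun τ => ‖V τ‖ ^ 2) σ]

variable [CompleteSpace X]

theorem inner_window (V : Lp X 2 (volume : Measure ℝ)) (h τ : ℝ) (k : X) :
    inner ℝ (∫ σ in 0..h, V (σ + τ)) k = ∫ σ in 0..h, inner ℝ (V (σ + τ)) k := by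
  have hi : IntervalIntegrable (fun σ => V (σ + τ)) volume 0 h := by
    have hl : LocallyIntegrable V volume := (Lp.memLp V).locallyIntegrable one_le_two
    have : IntervalIntegrable V volume (0 + τ) (h + τ) := 
      (hl.integrableOn_isCompact isCompact_uIcc).intervalIntegrable
    simpa using this.comp_add_right τ
  simp only [intervalIntegral, inner_sub_left]
  rw [real_inner_comm, real_inner_comm k, ← integral_inner hi.1 k, ← integral_inner hi.2 k]
  simp only [real_inner_comm k]

theorem integrable_inner_window (A : Set ℝ) {h : ℝ} (hh : 0 ≤ h)
    (V K : Lp X 2 (volume : Measure ℝ)) :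
    Integrable (fun τ => (inner ℝ (∫ σ in 0..h, V (σ + τ)) (K τ) : ℝ)) (volume.restrict A) := by
  simp only [inner_window]
  simp only [intervalIntegral.integral_of_le hh]
  exact (integrable_translate_inner A 0 h V K).integral_prod_left

/-- Exchanging the integrals turns the time window into a family of translations of `V`, whose
continuity in `L²` can then be used. -/
theorem integral_inner_window (A : Set ℝ) {h : ℝ} (hh : 0 ≤ h)
    (V K : Lp X 2 (volume : Measure ℝ)) :
    ∫ τ in A, inner ℝ (∫ σ in 0..h, V (σ + τ)) (K τ) =
      ∫ σ in 0..h, setPairing A (translate σ V) K := by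
  simp only [inner_window]
  simp only [intervalIntegral.integral_of_le hh]
  rw [integral_integral_swap (integrable_translate_inner A 0 h V K)]
  congr 1
  funext σ
  rw [setPairing_eq]
  refine integral_congr_ae ?_
  filter_upwards [ae_restrict_of_ae (coeFn_translate σ V)] with τ hτ
  rw [hτ]

/-- Averages over short time windows converge. -/
theorem tendsto_integral_inner_window (A : Set ℝ) (V : Lp X 2 (volume : Measure ℝ))
    {K : ℝ → Lp X 2 (volume : Measure ℝ)} {K₀ : Lp X 2 (volume : Measure ℝ)}
    (hK : Tendsto K (𝓝[>] 0) (𝓝 K₀)) :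
    Tendsto (fun h => h⁻¹ * ∫ τ in A, inner ℝ (∫ σ in 0..h, V (σ + τ)) (K h τ)) (𝓝[>] 0)
      (𝓝 (setPairing A V K₀)) := by
  rw [Metric.tendsto_nhds]
  intro ε hε
  -- The limit is taken jointly in the shift `σ` and the parameter `h`: for `0 < σ ≤ h` both are
  -- small, so the average over `σ` inherits the bound.
  have h1 : Tendsto (fun p : ℝ × ℝ => setPairing A (translate p.1 V) (K p.2)) (𝓝 0 ×ˢ 𝓝[>] 0)
      (𝓝 (setPairing A V K₀)) := by
    exact tendsto_setPairing A ((tendsto_translate V).comp tendsto_fst) (hK.comp tendsto_snd)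
  have h2 := (Metric.tendsto_nhds.1 h1) (ε / 2) (half_pos hε)
  obtain ⟨pa, hpa, pb, hpb, hab⟩ := eventually_prod_iff.1 h2
  obtain ⟨δ, hδ, hδ'⟩ := Metric.eventually_nhds_iff.1 hpa
  filter_upwards [hpb, Ioo_mem_nhdsGT hδ] with h hh hhδ
  rw [integral_inner_window A hhδ.1.le]
  have hc : Continuous fun σ => setPairing A (translate σ V) (K h) :=
    continuous_iff_continuousAt.2 fun σ =>
      tendsto_setPairing A ((continuous_translate V).tendsto σ) tendsto_const_nhds
  have hb : ‖∫ σ in 0..h, (setPairing A (translate σ V) (K h) - setPairing A V K₀)‖ ≤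
      ε / 2 * |h - 0| := by
    refine intervalIntegral.norm_integral_le_of_norm_le_const fun σ hσ => ?_
    rw [uIoc_of_le hhδ.1.le] at hσ
    have := hab (x := σ) (hδ' (by
      rw [Real.dist_0_eq_abs, abs_of_pos hσ.1]; exact hσ.2.trans_lt hhδ.2)) hh
    exact this.le
  rw [intervalIntegral.integral_sub (hc.intervalIntegrable _ _) (by simp)] at hb
  rw [intervalIntegral.integral_const, sub_zero, abs_of_pos hhδ.1, smul_eq_mul] at hb
  have hne : h ≠ 0 := hhδ.1.ne'
  have e : h⁻¹ * (∫ σ in 0..h, setPairing A (translate σ V) (K h)) - setPairing A V K₀ =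
      h⁻¹ * ((∫ σ in 0..h, setPairing A (translate σ V) (K h)) - h * setPairing A V K₀) := by
    field_simp
  rw [Real.dist_eq, e, abs_mul, abs_of_pos (inv_pos.2 hhδ.1)]
  calc h⁻¹ * _ ≤ h⁻¹ * (ε / 2 * h) := by
        gcongr
        · exact (inv_pos.2 hhδ.1).le
        · exact hb
    _ = ε / 2 := by field_simp
    _ < ε := half_lt_self hε

end Translation

/-! ### The chain rule from a trapezoidal estimate -/

theorem ae_of_ae_add_left {p : ℝ → Prop} (h : ℝ) (hp : ∀ᵐ τ, p τ) : ∀ᵐ τ, p (h + τ) :=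
  (measurePreserving_add_left volume h).quasiMeasurePreserving.ae hp

/-- A chain rule in integrated form: if the increments of `E` agree with the trapezoidal expression
`½ ∑ᵢ ⟪Uᵢ(t) - Uᵢ(s), Gᵢ(t) + Gᵢ(s)⟫` up to a quadratic error, where `Vᵢ` is the time derivative of
`Uᵢ`, then the derivative of `E` is `∑ᵢ ⟪Vᵢ, Gᵢ⟫`. -/
theorem exists_increment_eq_integral_of_estimate {ι : Type*} [Fintype ι] {X : Type*}
    [NormedAddCommGroup X] [InnerProductSpace ℝ X] [CompleteSpace X] {T : ℝ} {E : ℝ → ℝ}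
    {U V G : ι → ℝ → X} (hE : IntegrableOn E (Ioo 0 T))
    (hU : ∀ i, MemLp (U i) 2 (volume.restrict (Ioo 0 T)))
    (hV : ∀ i, MemLp (V i) 2 (volume.restrict (Ioo 0 T)))
    (hG : ∀ i, MemLp (G i) 2 (volume.restrict (Ioo 0 T)))
    {S : Set ℝ} (hST : S ⊆ Ioo 0 T) (hS : ∀ᵐ t ∂(volume.restrict (Ioo 0 T)), t ∈ S)
    (hinc : ∀ i, ∀ s ∈ S, ∀ t ∈ S, U i t - U i s = ∫ x in s..t, V i x) {C : ℝ}
    (hest : ∀ s ∈ S, ∀ t ∈ S,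
      |E t - E s - 1 / 2 * ∑ i, inner ℝ (U i t - U i s) (G i t + G i s)| ≤
        C * ∑ i, ‖U i t - U i s‖ ^ 2) :
    ∃ S' ⊆ S, (∀ᵐ t ∂(volume.restrict (Ioo 0 T)), t ∈ S') ∧
      ∀ s ∈ S', ∀ t ∈ S', E t - E s = ∫ x in s..t, ∑ i, inner ℝ (V i x) (G i x) := by
  have hm : MeasurableSet (Ioo 0 T) := measurableSet_Ioo
  set E₀ : ℝ → ℝ := (Ioo 0 T).indicator E with hE₀
  have hE₀i : Integrable E₀ := (integrable_indicator_iff hm).2 hE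
  have ext : ∀ F : ι → ℝ → X, (∀ i, MemLp (F i) 2 (volume.restrict (Ioo 0 T))) →
      ∃ F₀ : ι → Lp X 2 (volume : Measure ℝ), ∀ i, ∀ᵐ t, t ∈ Ioo 0 T → F₀ i t = F i t := by
    intro F hF
    have hF' := fun i => (memLp_indicator_iff_restrict hm).2 (hF i)
    refine ⟨fun i => (hF' i).toLp, fun i => ?_⟩
    filter_upwards [(hF' i).coeFn_toLp] with t ht ht'
    rw [ht, indicator_of_mem ht']
  obtain ⟨U₀, hU₀⟩ := ext U hU
  obtain ⟨V₀, hV₀⟩ := ext V hV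
  obtain ⟨G₀, hG₀⟩ := ext G hG
  have hD := LocallyIntegrable.ae_hasDerivAt_integral hE₀i.locallyIntegrable
  -- Keep the times at which the primitive of `E` is differentiable with derivative `E`; there the
  -- difference quotients below recover the values of `E`.
  refine ⟨{t | t ∈ S ∧ HasDerivAt (fun x => ∫ τ in (0:ℝ)..x, E₀ τ) (E₀ t) t}, fun t ht => ht.1,
    ?_, ?_⟩
  · filter_upwards [hS, ae_restrict_of_ae hD] with t h1 h2 using ⟨h1, h2 0⟩
  set Q : ℝ → ℝ := fun x => ∫ τ in (0:ℝ)..x, E₀ τ with hQ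
  have key : ∀ s t, s ≤ t → s ∈ S → t ∈ S → HasDerivAt Q (E₀ s) s → HasDerivAt Q (E₀ t) t →
      E t - E s = ∫ x in s..t, ∑ i, inner ℝ (V i x) (G i x) := by
    intro s t hst hs ht hs' ht'
    have hs0 := hST hs
    have ht0 := hST ht
    set A := Ioc s t with hA
    have hAT : A ⊆ Ioo 0 T := fun x hx => ⟨hs0.1.trans hx.1, hx.2.trans_lt ht0.2⟩
    have hint : ∫ x in s..t, ∑ i, inner ℝ (V i x) (G i x) = ∑ i, setPairing A (V₀ i) (G₀ i) := by
      simp only [setPairing_eq]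
      rw [← integral_finsetSum _ fun i _ => (L2.integrable_inner (𝕜 := ℝ) (V₀ i) (G₀ i)).restrict,
        intervalIntegral.integral_of_le hst]
      refine setIntegral_congr_ae measurableSet_Ioc ?_
      filter_upwards [ae_all_iff.2 hV₀, ae_all_iff.2 hG₀] with x h1 h2 hx
      refine Finset.sum_congr rfl fun i _ => ?_
      rw [h1 i (hAT hx), h2 i (hAT hx)]
    have hK1 : ∀ i, Tendsto (fun h => (1 / 2 : ℝ) • (translate h (G₀ i) + G₀ i)) (𝓝[>] 0)
        (𝓝 (G₀ i)) := by
      intro i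
      have := (((tendsto_translate (G₀ i)).mono_left (nhdsWithin_le_nhds (s := Ioi 0))).add_const
        (G₀ i)).const_smul (1 / 2 : ℝ)
      have e : (1 / 2 : ℝ) • (G₀ i + G₀ i) = G₀ i := by
        rw [← two_smul ℝ, smul_smul]; norm_num
      rwa [e] at this
    -- For the error term: one factor of `‖U(τ + h) - U(τ)‖²` is written as the window integral of
    -- `V`, which absorbs `h⁻¹`, and the other tends to zero in `L²`.
    have hK2 : ∀ i, Tendsto (fun h => translate h (U₀ i) - U₀ i) (𝓝[>] 0) (𝓝 0) := by
      intro i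
      have := ((tendsto_translate (U₀ i)).mono_left (nhdsWithin_le_nhds (s := Ioi 0))).sub_const
        (U₀ i)
      rwa [sub_self] at this
    have hJ1 := tendsto_finsetSum Finset.univ fun i _ =>
      tendsto_integral_inner_window A (V₀ i) (hK1 i)
    have hJ2 := (tendsto_finsetSum Finset.univ fun i _ =>
      tendsto_integral_inner_window A (V₀ i) (hK2 i)).const_mul C
    have hz : C * ∑ i, setPairing A (V₀ i) 0 = 0 := by simp [setPairing]
    rw [hz] at hJ2
    -- After a shift of variables the integral is an increment of `Q` over `[t, t + h]` minus one
    -- over `[s, s + h]`.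
    have hI : Tendsto (fun h => h⁻¹ * ∫ τ in A, (E₀ (h + τ) - E₀ τ)) (𝓝[>] 0)
        (𝓝 (E₀ t - E₀ s)) := by
      refine (ht'.tendsto_slope_zero_right.sub hs'.tendsto_slope_zero_right).congr fun h => ?_
      have hii : ∀ a b, IntervalIntegrable E₀ volume a b := fun a b => hE₀i.intervalIntegrable
      rw [integral_sub (hE₀i.comp_add_left h).restrict hE₀i.restrict,
        ← intervalIntegral.integral_of_le hst, ← intervalIntegral.integral_of_le hst,
        intervalIntegral.integral_comp_add_left,
        ← intervalIntegral.integral_interval_sub_left (hii 0 (h + t)) (hii 0 (h + s)),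
        ← intervalIntegral.integral_interval_sub_left (hii 0 t) (hii 0 s),
        add_comm h t, add_comm h s, smul_eq_mul, smul_eq_mul]
      simp only [hQ]
      ring
    have hlim := ((hI.sub hJ1).abs)
    have hle : |E₀ t - E₀ s - ∑ i, setPairing A (V₀ i) (G₀ i)| ≤ 0 := by
      refine le_of_tendsto_of_tendsto hlim hJ2 ?_
      filter_upwards [Ioo_mem_nhdsGT (sub_pos.2 ht0.2)] with h hh
      have hh0 : 0 ≤ h := hh.1.le
      set w : ι → ℝ → X := fun i τ => ∫ σ in 0..h, V₀ i (σ + τ) with hw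
      have hi1 : ∀ i, Integrable (fun τ => (inner ℝ (w i τ)
          (((1 / 2 : ℝ) • (translate h (G₀ i) + G₀ i) : Lp X 2 (volume : Measure ℝ)) τ) : ℝ))
          (volume.restrict A) := fun i => integrable_inner_window A hh0 _ _
      have hi2 : ∀ i, Integrable (fun τ => (inner ℝ (w i τ)
          ((translate h (U₀ i) - U₀ i : Lp X 2 (volume : Measure ℝ)) τ) : ℝ))
          (volume.restrict A) := fun i => integrable_inner_window A hh0 _ _
      have hi0 : Integrable (fun τ => E₀ (h + τ) - E₀ τ) (volume.restrict A) :=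
        (hE₀i.comp_add_left h).restrict.sub hE₀i.restrict
      rw [← Finset.mul_sum, ← Finset.mul_sum, ← mul_sub, abs_mul, abs_of_pos (inv_pos.2 hh.1),
        mul_left_comm]
      refine mul_le_mul_of_nonneg_left ?_ (inv_pos.2 hh.1).le
      rw [← integral_finsetSum _ fun i _ => hi1 i, ← integral_finsetSum _ fun i _ => hi2 i,
        ← integral_sub hi0
          (integrable_finsetSum _ fun i _ => hi1 i), ← integral_const_mul, ← Real.norm_eq_abs]
      refine norm_integral_le_of_norm_le
        ((integrable_finsetSum _ fun i _ => hi2 i).const_mul C) ?_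
      have hS' : ∀ᵐ τ, τ ∈ Ioo 0 T → τ ∈ S := (ae_restrict_iff' hm).1 hS
      filter_upwards [ae_restrict_mem measurableSet_Ioc, ae_restrict_of_ae hS',
        ae_restrict_of_ae (ae_of_ae_add_left h hS'),
        ae_restrict_of_ae (ae_all_iff.2 hG₀),
        ae_restrict_of_ae (ae_of_ae_add_left h (ae_all_iff.2 hG₀)),
        ae_restrict_of_ae (ae_all_iff.2 hU₀),
        ae_restrict_of_ae (ae_of_ae_add_left h (ae_all_iff.2 hU₀)),
        ae_restrict_of_ae (ae_all_iff.2 fun i => coeFn_translate h (G₀ i)),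
        ae_restrict_of_ae (ae_all_iff.2 fun i => coeFn_translate h (U₀ i)),
        ae_restrict_of_ae (ae_all_iff.2 fun i =>
          Lp.coeFn_smul (1 / 2 : ℝ) (translate h (G₀ i) + G₀ i)),
        ae_restrict_of_ae (ae_all_iff.2 fun i => Lp.coeFn_add (translate h (G₀ i)) (G₀ i)),
        ae_restrict_of_ae (ae_all_iff.2 fun i => Lp.coeFn_sub (translate h (U₀ i)) (U₀ i))]
        with τ hτ e1 e2 e3 e4 e5 e6 e7 e8 e9 e10 e11
      have hτT : τ ∈ Ioo 0 T := hAT hτ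
      have hτhT : h + τ ∈ Ioo 0 T := ⟨by linarith [hτT.1, hh.1], by linarith [hτ.2, hh.2]⟩
      have hwU : ∀ i, w i τ = U i (h + τ) - U i τ := by
        intro i
        rw [hinc i _ (e1 hτT) _ (e2 hτhT)]
        simp only [hw]
        rw [intervalIntegral.integral_comp_add_right (fun x => V₀ i x) τ, zero_add]
        refine intervalIntegral.integral_congr_ae ?_
        filter_upwards [hV₀ i] with x hx hx'
        rw [uIoc_of_le (by linarith)] at hx'
        exact hx ⟨hτT.1.trans hx'.1, hx'.2.trans_lt hτhT.2⟩
      have hmain := hest _ (e1 hτT) _ (e2 hτhT)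
      rw [Real.norm_eq_abs]
      have f1 : E₀ (h + τ) = E (h + τ) := indicator_of_mem hτhT _
      have f2 : E₀ τ = E τ := indicator_of_mem hτT _
      have f3 : ∀ i, (inner ℝ (w i τ)
          (((1 / 2 : ℝ) • (translate h (G₀ i) + G₀ i) : Lp X 2 (volume : Measure ℝ)) τ) : ℝ) =
          1 / 2 * inner ℝ (U i (h + τ) - U i τ) (G i (h + τ) + G i τ) := by
        intro i
        rw [e9 i, Pi.smul_apply, e10 i, Pi.add_apply, e7 i, e4 i hτhT, e3 i hτT, hwU,
          real_inner_smul_right]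
      have f4 : ∀ i, (inner ℝ (w i τ)
          ((translate h (U₀ i) - U₀ i : Lp X 2 (volume : Measure ℝ)) τ) : ℝ) =
          ‖U i (h + τ) - U i τ‖ ^ 2 := by
        intro i
        rw [e11 i, Pi.sub_apply, e8 i, e6 i hτhT, e5 i hτT, hwU, real_inner_self_eq_norm_sq]
      simp only [f1, f2, f3, f4, ← Finset.mul_sum]
      exact hmain
    have h0 := abs_eq_zero.1 (le_antisymm hle (abs_nonneg _))
    rw [hint]
    rw [hE₀, indicator_of_mem hs0, indicator_of_mem ht0] at h0
    linarith
  rintro s ⟨hs, hs'⟩ t ⟨ht, ht'⟩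
  rcases le_total s t with hst | hst
  · exact key s t hst hs ht hs' ht'
  · rw [intervalIntegral.integral_symm, ← key t s hst ht hs ht' hs', neg_sub]

/-! ### The embedding of `H²` into `L^∞` under the cone condition -/

/-- The mollifier `ε⁻ᵈ θ((· - x)/ε)`. -/
def rescale (θ : Space d → ℝ) (x : Space d) (ε : ℝ) (y : Space d) : ℝ :=
  (ε ^ d)⁻¹ * θ (ε⁻¹ • (y - x))

/-- The weighted average `∫ g(x + ε z) θ(z) dz`, written as an integral over `Ω`. -/
def weightedAverage {Ω : Set (Space d)} (g : L2 Ω) (θ : Space d → ℝ) (x : Space d) (ε : ℝ) : ℝ :=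
  ∫ y in Ω, g y * rescale θ x ε y

/-- Multiplication by the `i`-th coordinate. -/
def coordMul (i : Fin d) (θ : Space d → ℝ) (z : Space d) : ℝ := z i * θ z

theorem contDiff_coordMul (i : Fin d) {θ : Space d → ℝ} (hθ : ContDiff ℝ ∞ θ) :
    ContDiff ℝ ∞ (coordMul i θ) := by
  have : ContDiff ℝ ∞ fun z : Space d => z i := (EuclideanSpace.proj (𝕜 := ℝ) i).contDiff
  exact this.mul hθ

theorem tsupport_coordMul_subset (i : Fin d) (θ : Space d → ℝ) :
    tsupport (coordMul i θ) ⊆ tsupport θ :=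
  closure_mono fun z hz h0 => hz (by simp [coordMul, h0])

theorem hasCompactSupport_coordMul (i : Fin d) {θ : Space d → ℝ} (hθ : HasCompactSupport θ) :
    HasCompactSupport (coordMul i θ) :=
  hθ.of_isClosed_subset (isClosed_tsupport _) (tsupport_coordMul_subset i θ)

theorem contDiff_rescale {θ : Space d → ℝ} (hθ : ContDiff ℝ ∞ θ) (x : Space d) (ε : ℝ) :
    ContDiff ℝ ∞ (rescale θ x ε) :=
  contDiff_const.mul (hθ.comp ((contDiff_id.sub contDiff_const).const_smul ε⁻¹))

theorem tsupport_rescale_subset (θ : Space d → ℝ) (x : Space d) (ε : ℝ) :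
    tsupport (rescale θ x ε) ⊆ {y | ε⁻¹ • (y - x) ∈ tsupport θ} := by
  refine closure_minimal (fun y hy => subset_tsupport _ fun h0 => hy (by simp [rescale, h0])) ?_
  exact (isClosed_tsupport θ).preimage (by fun_prop)

theorem hasCompactSupport_rescale {θ : Space d → ℝ} (hθ : HasCompactSupport θ) (x : Space d)
    {ε : ℝ} (hε : 0 < ε) : HasCompactSupport (rescale θ x ε) := by
  have hc : IsCompact ((fun z : Space d => x + ε • z) '' tsupport θ) :=
    IsCompact.image hθ (by fun_prop)
  refine hc.of_isClosed_subset (isClosed_tsupport _) fun y hy => ?_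
  refine ⟨_, tsupport_rescale_subset θ x ε hy, ?_⟩
  simp [smul_smul, mul_inv_cancel₀ hε.ne']

theorem hasDerivAt_rescale {θ : Space d → ℝ} (hθ : ContDiff ℝ ∞ θ) (x y : Space d) {ε : ℝ}
    (hε : 0 < ε) :
    HasDerivAt (fun ε => rescale θ x ε y) (-((ε ^ (d + 1))⁻¹ * (d * θ (ε⁻¹ • (y - x)) +
      fderiv ℝ θ (ε⁻¹ • (y - x)) (ε⁻¹ • (y - x))))) ε := by
  have h1 : HasDerivAt (fun ε : ℝ => (ε ^ d)⁻¹) (-(d * ε ^ (d - 1)) / (ε ^ d) ^ 2) ε :=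
    (hasDerivAt_pow d ε).inv (pow_pos hε d).ne'
  have h2 : HasDerivAt (fun ε : ℝ => ε⁻¹ • (y - x)) ((-(ε ^ 2)⁻¹) • (y - x)) ε :=
    (hasDerivAt_inv hε.ne').smul_const _
  have h3 : HasFDerivAt θ (fderiv ℝ θ (ε⁻¹ • (y - x))) (ε⁻¹ • (y - x)) :=
    (hθ.differentiable (by simp) _).hasFDerivAt
  refine (h1.mul (h3.comp_hasDerivAt ε h2)).congr_deriv ?_
  have e : (-(ε ^ 2)⁻¹) • (y - x) = (-ε⁻¹) • (ε⁻¹ • (y - x)) := by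
    rw [smul_smul]; congr 1; ring
  rw [e, map_smul, smul_eq_mul]
  have e2 : -(d * ε ^ (d - 1)) / (ε ^ d) ^ 2 = -(d * (ε ^ (d + 1))⁻¹) := by
    rcases d with _ | d
    · simp
    · field_simp
      simp only [Nat.add_sub_cancel]
      ring
  rw [e2, pow_succ, mul_inv, Function.comp_apply]
  ring

theorem fderiv_rescale_coordMul {θ : Space d → ℝ} (hθ : ContDiff ℝ ∞ θ) (x y : Space d) {ε : ℝ}
    (i : Fin d) :
    fderiv ℝ (rescale (coordMul i θ) x ε) y (EuclideanSpace.single i 1) =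
      (ε ^ (d + 1))⁻¹ * (θ (ε⁻¹ • (y - x)) + (ε⁻¹ • (y - x)) i *
        fderiv ℝ θ (ε⁻¹ • (y - x)) (EuclideanSpace.single i 1)) := by
  have h2 : HasFDerivAt (fun y : Space d => ε⁻¹ • (y - x))
      (ε⁻¹ • ContinuousLinearMap.id ℝ (Space d)) y := ((hasFDerivAt_id y).sub_const x).const_smul ε⁻¹
  have h3 : HasFDerivAt θ (fderiv ℝ θ (ε⁻¹ • (y - x))) (ε⁻¹ • (y - x)) :=
    (hθ.differentiable (by simp) _).hasFDerivAt
  have h4 : HasFDerivAt (fun z : Space d => z i) (EuclideanSpace.proj (𝕜 := ℝ) i)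
      (ε⁻¹ • (y - x)) := (EuclideanSpace.proj (𝕜 := ℝ) i).hasFDerivAt
  have h5 := ((h4.mul h3).comp y h2).const_mul ((ε ^ d)⁻¹)
  have h6 : HasFDerivAt (rescale (coordMul i θ) x ε) _ y := h5
  rw [h6.fderiv]
  simp
  ring

theorem integrable_coeFn {Ω : Set (Space d)} (hb : Bornology.IsBounded Ω) (g : L2 Ω) :
    Integrable g (volume.restrict Ω) := by
  have : IsFiniteMeasure (volume.restrict Ω) := ⟨by simpa using hb.measure_lt_top⟩
  exact (Lp.memLp g).integrable one_le_two

/-- Differentiating `u(x + ε z)` in `ε` formally gives `∑ᵢ zᵢ ∂ᵢu(x + ε z)`, hence the weights `zᵢ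
θ`. For a weak derivative the kernel is differentiated instead. The result has the same form as the
original average, so the lemma can be iterated. -/
theorem hasDerivAt_weightedAverage {Ω : Set (Space d)} (hb : Bornology.IsBounded Ω) {u : L2 Ω}
    {du : Fin d → L2 Ω} (hu : ∀ i, IsWeakDeriv Ω i u (du i)) {θ : Space d → ℝ}
    (hθ : ContDiff ℝ ∞ θ) (hc : HasCompactSupport θ) {x : Space d} {ε : ℝ} (hε : 0 < ε)
    (hx : ∀ z ∈ tsupport θ, x + ε • z ∈ Ω) :
    HasDerivAt (weightedAverage u θ x) (∑ i, weightedAverage (du i) (coordMul i θ) x ε) ε := by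
  set ψ : Space d → ℝ := fun w => d * θ w + fderiv ℝ θ w w with hψ
  have hψc : Continuous ψ :=
    (continuous_const.mul hθ.continuous).add
      ((hθ.continuous_fderiv (by simp)).clm_apply continuous_id)
  have hψs : HasCompactSupport ψ := by
    refine HasCompactSupport.of_support_subset_isCompact hc fun w hw => ?_
    by_contra hne
    refine hw ?_
    have h1 : θ w = 0 := image_eq_zero_of_notMem_tsupport hne
    have h2 : fderiv ℝ θ w = 0 := by
      by_contra h
      exact hne (tsupport_fderiv_subset ℝ (subset_tsupport _ h))
    simp [hψ, h1, h2]
  obtain ⟨B, hB⟩ := hψs.exists_bound_of_continuous hψc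
  have hui := integrable_coeFn hb u
  have hk : ∀ ε, Continuous (rescale θ x ε) := fun ε => (contDiff_rescale hθ x ε).continuous
  have hder : HasDerivAt (weightedAverage u θ x)
      (∫ y in Ω, u y * (-((ε ^ (d + 1))⁻¹ * ψ (ε⁻¹ • (y - x))))) ε := by
    refine (hasDerivAt_integral_of_dominated_loc_of_deriv_le (s := Ioi (ε / 2))
      (bound := fun y => ‖u y‖ * (((ε / 2) ^ (d + 1))⁻¹ * B)) (Ioi_mem_nhds (half_lt_self hε))
      (F := fun ε y => u y * rescale θ x ε y)
      (F' := fun ε y => u y * (-((ε ^ (d + 1))⁻¹ * ψ (ε⁻¹ • (y - x)))))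
      (Eventually.of_forall fun ε => hui.aestronglyMeasurable.mul (hk ε).aestronglyMeasurable)
      (integrable_mul_test u (hk ε) (hasCompactSupport_rescale hc x hε)) ?_ ?_
      (hui.norm.mul_const _) ?_).2
    · refine hui.aestronglyMeasurable.mul (Continuous.aestronglyMeasurable ?_)
      exact (continuous_const.mul (hψc.comp (by fun_prop))).neg
    · refine ae_of_all _ fun y ε' hε' => ?_
      have hε'0 : 0 < ε' := (half_pos hε).trans hε'
      rw [norm_mul, norm_neg, norm_mul, Real.norm_of_nonneg (by positivity : 0 ≤ (ε' ^ (d + 1))⁻¹)]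
      gcongr
      · exact hε'.le
      · exact hB _
    · refine ae_of_all _ fun y ε' hε' => ?_
      exact (hasDerivAt_rescale hθ x y ((half_pos hε).trans hε')).const_mul _
  -- The `ε`-derivative of the kernel is minus the divergence in `y` of the kernels with weights `zᵢ
  -- θ`; these are supported in `Ω`, so the definition of the weak derivative applies.
  convert! hder using 1
  have hts : ∀ i, tsupport (rescale (coordMul i θ) x ε) ⊆ Ω := by
    intro i y hy
    have := hx _ (tsupport_coordMul_subset i θ (tsupport_rescale_subset _ x ε hy))
    simpa [smul_smul, mul_inv_cancel₀ hε.ne'] using this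
  have h1 : ∀ i, weightedAverage (du i) (coordMul i θ) x ε =
      -∫ y in Ω, u y * fderiv ℝ (rescale (coordMul i θ) x ε) y (EuclideanSpace.single i 1) := by
    intro i
    rw [hu i _ (contDiff_rescale (contDiff_coordMul i hθ) x ε)
      (hasCompactSupport_rescale (hasCompactSupport_coordMul i hc) x hε) (hts i), neg_neg]
    rfl
  simp only [h1]
  rw [Finset.sum_neg_distrib, ← integral_finsetSum _ fun i _ => integrable_mul_test u
    (continuous_fderiv_test (contDiff_rescale (contDiff_coordMul i hθ) x ε) _)
    ((hasCompactSupport_rescale (hasCompactSupport_coordMul i hc) x hε).fderiv_apply (𝕜 := ℝ) _),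
    ← integral_neg]
  congr 1
  funext y
  simp only [fderiv_rescale_coordMul hθ, hψ]
  rw [← Finset.mul_sum, ← Finset.mul_sum, Finset.sum_add_distrib]
  set w := ε⁻¹ • (y - x) with hw
  have e : fderiv ℝ θ w w = ∑ i, w i * fderiv ℝ θ w (EuclideanSpace.single i 1) := by
    have := congrArg (fderiv ℝ θ w) ((EuclideanSpace.basisFun (Fin d) ℝ).sum_repr w)
    rw [← this]
    simp [map_sum]
  rw [e]
  simp

theorem abs_integral_mul_le {α : Type*} [MeasurableSpace α] {ν : Measure α} (g : Lp ℝ 2 ν)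
    {k : α → ℝ} (hk : MemLp k 2 ν) : |∫ y, g y * k y ∂ν| ≤ ‖g‖ * √(∫ y, k y ^ 2 ∂ν) := by
  have h1 : ∫ y, g y * k y ∂ν = inner ℝ g hk.toLp := by
    rw [L2.inner_def]
    refine integral_congr_ae ?_
    filter_upwards [hk.coeFn_toLp] with y hy
    rw [hy]
    simp [mul_comm]
  have h2 : ‖hk.toLp‖ = √(∫ y, k y ^ 2 ∂ν) := by
    rw [norm_eq_sqrt_real_inner, L2.inner_def]
    congr 1
    refine integral_congr_ae ?_
    filter_upwards [hk.coeFn_toLp] with y hy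
    rw [hy]
    simp [pow_two]
  rw [h1, ← h2]
  exact abs_real_inner_le_norm _ _

/-- Cauchy-Schwarz, with the kernel of squared `L²` norm `ε ^ (-d) ∫ θ²` on the whole space. -/
theorem abs_weightedAverage_le {Ω : Set (Space d)} (hd : d ≤ 3) (g : L2 Ω) {θ : Space d → ℝ}
    (hθ : Continuous θ) (hc : HasCompactSupport θ) (x : Space d) {ε : ℝ} (hε : 0 < ε)
    (hε1 : ε ≤ 1) :
    |weightedAverage g θ x ε| ≤ ‖g‖ * √(∫ z, θ z ^ 2) * (ε * √ε)⁻¹ := by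
  have hk : Continuous (rescale θ x ε) :=
    continuous_const.mul (hθ.comp (by fun_prop))
  have hkc := hasCompactSupport_rescale hc x hε
  have hk2 : MemLp (rescale θ x ε) 2 volume := hk.memLp_of_hasCompactSupport hkc
  refine (abs_integral_mul_le g (hk2.restrict Ω)).trans ?_
  rw [mul_assoc]
  refine mul_le_mul_of_nonneg_left ?_ (norm_nonneg _)
  have h1 : ∫ y in Ω, rescale θ x ε y ^ 2 ≤ ∫ y, rescale θ x ε y ^ 2 :=
    setIntegral_le_integral ((memLp_two_iff_integrable_sq hk2.1).1 hk2)
      (ae_of_all _ fun y => sq_nonneg _)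
  have h2 : ∫ y, rescale θ x ε y ^ 2 = (ε ^ d)⁻¹ * ∫ z, θ z ^ 2 := by
    simp only [rescale, mul_pow]
    rw [integral_const_mul, integral_sub_right_eq_self (fun y => θ (ε⁻¹ • y) ^ 2) x,
      Measure.integral_comp_inv_smul_of_nonneg volume (fun z => θ z ^ 2) hε.le]
    simp only [finrank_euclideanSpace, Fintype.card_fin, smul_eq_mul]
    have : ε ^ d ≠ 0 := (pow_pos hε d).ne'
    field_simp
  -- The dimension restriction enters here: for `d ≤ 3` and `ε ≤ 1` the singularity is at most `ε ^
  -- (-3/2)` after the square root.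
  have h3 : (ε ^ d)⁻¹ ≤ (ε ^ 3)⁻¹ :=
    inv_anti₀ (pow_pos hε 3) (pow_le_pow_of_le_one hε.le hε1 hd)
  have h4 : √((ε ^ 3)⁻¹) = (ε * √ε)⁻¹ := by
    rw [Real.sqrt_inv]
    congr 1
    rw [show ε ^ 3 = ε ^ 2 * ε by ring, Real.sqrt_mul (by positivity), Real.sqrt_sq hε.le]
  rw [← h4, ← Real.sqrt_mul (integral_nonneg fun z => sq_nonneg _)]
  refine Real.sqrt_le_sqrt (h1.trans ?_)
  rw [h2, mul_comm]
  exact mul_le_mul_of_nonneg_left h3 (integral_nonneg fun z => sq_nonneg _)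

theorem continuous_coordMul (i : Fin d) {θ : Space d → ℝ} (hθ : Continuous θ) :
    Continuous (coordMul i θ) := by
  have : Continuous fun z : Space d => z i := (EuclideanSpace.proj (𝕜 := ℝ) i).continuous
  exact this.mul hθ

theorem integral_rescale (θ : Space d → ℝ) (x : Space d) {ε : ℝ} (hε : 0 < ε) :
    ∫ y, rescale θ x ε y = ∫ z, θ z := by
  simp only [rescale]
  rw [integral_const_mul, integral_sub_right_eq_self (fun y => θ (ε⁻¹ • y)) x,
    Measure.integral_comp_inv_smul_of_nonneg volume θ hε.le]
  simp only [finrank_euclideanSpace, Fintype.card_fin, smul_eq_mul]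
  have : ε ^ d ≠ 0 := (pow_pos hε d).ne'
  field_simp

/-- At almost every point the averages with weights in a fixed ball converge. -/
theorem ae_tendsto_weightedAverage {Ω : Set (Space d)} (hb : Bornology.IsBounded Ω)
    (hm : MeasurableSet Ω) (u : L2 Ω) {δ : ℝ} (hδ : 0 < δ) (K : ℝ) :
    -- The exceptional set is fixed before `c` and `θ`, because the cone axis depends on `x` in an
    -- uncontrolled way.
    ∀ᵐ x ∂(volume.restrict Ω), ∀ (c : Space d) (θ : Space d → ℝ), ‖c‖ ≤ K * δ → Continuous θ →
      Function.support θ ⊆ Metric.closedBall c δ → ∫ z, θ z = 1 →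
      Tendsto (weightedAverage u θ x) (𝓝[>] 0) (𝓝 (u x)) := by
  set u₀ : Space d → ℝ := Ω.indicator u with hu₀
  have hu₀i : Integrable u₀ := (integrable_indicator_iff hm).2 (integrable_coeFn hb u)
  filter_upwards [ae_restrict_of_ae (IsUnifLocDoublingMeasure.ae_tendsto_average_norm_sub
    (μ := volume) hu₀i.locallyIntegrable K), ae_restrict_mem hm] with x hx hxΩ
  intro c θ hcK hθ hs h1
  have hux : u₀ x = u x := indicator_of_mem hxΩ _
  have hcs : HasCompactSupport θ :=
    HasCompactSupport.of_support_subset_isCompact (isCompact_closedBall c δ) hs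
  obtain ⟨B, hB⟩ := hcs.exists_bound_of_continuous hθ
  have hB0 : 0 ≤ B := (norm_nonneg _).trans (hB 0)
  -- The averaging balls are centred at `x + ε c` rather than at `x`; `‖c‖ ≤ K δ` keeps `x` within
  -- `K` radii of the centre, as the differentiation theorem for doubling measures allows.
  have hlim := hx (l := 𝓝[>] (0 : ℝ)) (fun ε => x + ε • c) (fun ε => ε * δ) (by
      refine tendsto_nhdsWithin_iff.2 ⟨?_, ?_⟩
      · have : Tendsto (fun ε : ℝ => ε * δ) (𝓝 0) (𝓝 (0 * δ)) := tendsto_id.mul_const δ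
        rw [zero_mul] at this
        exact this.mono_left nhdsWithin_le_nhds
      · filter_upwards [self_mem_nhdsWithin] with ε hε using mul_pos hε hδ) (by
      filter_upwards [self_mem_nhdsWithin] with ε (hε : 0 < ε)
      rw [Metric.mem_closedBall, dist_eq_norm, sub_add_cancel_left, norm_neg, norm_smul,
        Real.norm_of_nonneg hε.le]
      nlinarith)
  have hlim' := hlim.const_mul (B * volume.real (Metric.closedBall (0 : Space d) δ))
  rw [mul_zero] at hlim'
  rw [tendsto_iff_norm_sub_tendsto_zero]
  refine squeeze_zero' (Eventually.of_forall fun _ => norm_nonneg _) ?_ hlim'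
  filter_upwards [self_mem_nhdsWithin] with ε (hε : 0 < ε)
  set s := Metric.closedBall (x + ε • c) (ε * δ) with hs'
  have hkc : Continuous (rescale θ x ε) := continuous_const.mul (hθ.comp (by fun_prop))
  have hkcs := hasCompactSupport_rescale hcs x hε
  have hkb : ∀ y, ‖rescale θ x ε y‖ ≤ (ε ^ d)⁻¹ * B := by
    intro y
    rw [rescale, norm_mul, Real.norm_of_nonneg (by positivity : 0 ≤ (ε ^ d)⁻¹)]
    exact mul_le_mul_of_nonneg_left (hB _) (by positivity)
  have hk0 : ∀ y, y ∉ s → rescale θ x ε y = 0 := by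
    intro y hy
    rw [rescale]
    by_contra hne
    have h2 : ε⁻¹ • (y - x) ∈ Metric.closedBall c δ := hs (right_ne_zero_of_mul hne)
    refine hy ?_
    rw [Metric.mem_closedBall, dist_eq_norm] at h2 ⊢
    have e : y - (x + ε • c) = ε • (ε⁻¹ • (y - x) - c) := by
      rw [smul_sub, smul_smul, mul_inv_cancel₀ hε.ne', one_smul]; abel
    rw [e, norm_smul, Real.norm_of_nonneg hε.le]
    exact mul_le_mul_of_nonneg_left h2 hε.le
  have hki : Integrable (rescale θ x ε) := hkc.integrable_of_hasCompactSupport hkcs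
  have hui : Integrable fun y => u₀ y * rescale θ x ε y :=
    hu₀i.mul_bdd hkc.aestronglyMeasurable (ae_of_all _ hkb)
  have e1 : weightedAverage u θ x ε - u x = ∫ y, (u₀ y - u₀ x) * rescale θ x ε y := by
    simp only [sub_mul]
    rw [integral_sub hui (hki.const_mul _), integral_const_mul, integral_rescale θ x hε, h1,
      mul_one, hux, weightedAverage, ← integral_indicator hm]
    congr 2
    funext y
    by_cases hy : y ∈ Ω <;> simp [hu₀, hy]
  have hsi : IntegrableOn (fun y => ‖u₀ y - u₀ x‖) s :=
    (hu₀i.integrableOn.sub (integrableOn_const (by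
      exact (isCompact_closedBall _ _).measure_lt_top.ne))).norm
  have hvol : volume.real s = ε ^ d * volume.real (Metric.closedBall (0 : Space d) δ) := by
    rw [Measure.real, hs', Measure.addHaar_closedBall_mul volume _ hε.le hδ.le, ENNReal.toReal_mul,
      ENNReal.toReal_ofReal (by positivity)]
    simp [Measure.real]
  have hvpos : 0 < volume.real (Metric.closedBall (0 : Space d) δ) :=
    ENNReal.toReal_pos (Metric.measure_closedBall_pos volume _ hδ).ne'
      (isCompact_closedBall _ _).measure_lt_top.ne
  rw [e1, setAverage_eq, hvol]
  calc ‖∫ y, (u₀ y - u₀ x) * rescale θ x ε y‖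
      = ‖∫ y in s, (u₀ y - u₀ x) * rescale θ x ε y‖ := by
        rw [setIntegral_eq_integral_of_forall_compl_eq_zero]
        intro y hy
        rw [hk0 y hy, mul_zero]
    _ ≤ ∫ y in s, ‖u₀ y - u₀ x‖ * ((ε ^ d)⁻¹ * B) := by
        refine norm_integral_le_of_norm_le (hsi.mul_const _) (ae_of_all _ fun y => ?_)
        rw [norm_mul]
        exact mul_le_mul_of_nonneg_left (hkb y) (norm_nonneg _)
    _ = _ := by
        rw [integral_mul_const]
        have : ε ^ d ≠ 0 := (pow_pos hε d).ne'
        simp only [smul_eq_mul]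
        field_simp

theorem abs_sub_le_of_abs_deriv_le {h H h' H' : ℝ → ℝ} {a b : ℝ} (hab : a ≤ b)
    (hh : ∀ x ∈ Icc a b, HasDerivAt h (h' x) x) (hH : ∀ x ∈ Icc a b, HasDerivAt H (H' x) x)
    (hle : ∀ x ∈ Icc a b, |h' x| ≤ H' x) : |h b - h a| ≤ H b - H a := by
  have := image_norm_le_of_norm_deriv_right_le_deriv_boundary' (f := fun x => h x - h a)
    (f' := h') (a := a) (b := b) (B := fun x => H x - H a) (B' := H')
    (fun x hx => ((hh x hx).continuousAt.sub continuousAt_const).continuousWithinAt)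
    (fun x hx => ((hh x (Ico_subset_Icc_self hx)).sub_const _).hasDerivWithinAt) (by simp)
    (fun x hx => ((hH x hx).continuousAt.sub continuousAt_const).continuousWithinAt)
    (fun x hx => ((hH x (Ico_subset_Icc_self hx)).sub_const _).hasDerivWithinAt)
    (fun x hx => by simpa using hle x (Ico_subset_Icc_self hx)) (right_mem_Icc.2 hab)
  simpa using this

/-- A function on `(0, 1]` whose second derivative is `O(ε ^ (-3/2))` is bounded. -/
theorem abs_le_of_abs_second_deriv_le {h h' h'' : ℝ → ℝ} {B : ℝ} (hB : 0 ≤ B)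
    (h1 : ∀ ε ∈ Ioc (0 : ℝ) 1, HasDerivAt h (h' ε) ε)
    (h2 : ∀ ε ∈ Ioc (0 : ℝ) 1, HasDerivAt h' (h'' ε) ε)
    (hle : ∀ ε ∈ Ioc (0 : ℝ) 1, |h'' ε| ≤ B * (ε * √ε)⁻¹) {ε : ℝ} (hε : ε ∈ Ioc (0 : ℝ) 1) :
    |h ε| ≤ |h 1| + |h' 1| + 4 * B := by
  have hsub : ∀ {ε : ℝ}, ε ∈ Ioc (0 : ℝ) 1 → ∀ x ∈ Icc ε 1, x ∈ Ioc (0 : ℝ) 1 :=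
    fun hε x hx => ⟨hε.1.trans_le hx.1, hx.2⟩
  have hd1 : ∀ ε ∈ Ioc (0 : ℝ) 1, |h' ε| ≤ |h' 1| + 2 * B * (√ε)⁻¹ := by
    intro ε hε
    -- Comparison with the primitive `-2 B ε ^ (-1/2)` of `B ε ^ (-3/2)`; the second integration
    -- below gives `4 B √ε`, which is bounded.
    have := abs_sub_le_of_abs_deriv_le (h := h') (h' := h'') (H := fun x => -2 * B * (√x)⁻¹)
      (H' := fun x => B * (x * √x)⁻¹) hε.2 (fun x hx => h2 x (hsub hε x hx))
      (fun x hx => by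
        have hx0 := (hsub hε x hx).1
        have hs := Real.sqrt_pos.2 hx0
        refine (((Real.hasDerivAt_sqrt hx0.ne').inv hs.ne').const_mul (-2 * B)).congr_deriv ?_
        rw [Real.sq_sqrt hx0.le]
        field_simp) (fun x hx => hle x (hsub hε x hx))
    have h3 := abs_sub_abs_le_abs_sub (h' ε) (h' 1)
    rw [abs_sub_comm] at h3
    simp only [Real.sqrt_one, inv_one, mul_one] at this
    nlinarith
  have := abs_sub_le_of_abs_deriv_le (h := h) (h' := h') (H := fun x => |h' 1| * x + 4 * B * √x)
      (H' := fun x => |h' 1| + 2 * B * (√x)⁻¹) hε.2 (fun x hx => h1 x (hsub hε x hx))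
      (fun x hx => by
        have hx0 := (hsub hε x hx).1
        have hs := Real.sqrt_pos.2 hx0
        refine (((hasDerivAt_id x).const_mul |h' 1|).add
          ((Real.hasDerivAt_sqrt hx0.ne').const_mul (4 * B))).congr_deriv ?_
        field_simp
        ring) (fun x hx => hd1 x (hsub hε x hx))
  have h3 := abs_sub_abs_le_abs_sub (h ε) (h 1)
  rw [abs_sub_comm] at h3
  simp only [Real.sqrt_one, mul_one] at this
  have h4 : 0 ≤ |h' 1| * ε := mul_nonneg (abs_nonneg _) hε.1.le
  have h5 : 0 ≤ 4 * B * √ε := by positivity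
  linarith

theorem norm_grad_le {Ω : Set (Space d)} (u : H1 Ω) (i : Fin d) : ‖u.grad i‖ ≤ ‖u‖ :=
  (PiLp.norm_apply_le u.1.snd i).trans (WithLp.norm_snd_le (p := 2) _ u.1)

theorem norm_toL2_le {Ω : Set (Space d)} (u : H1 Ω) : ‖u.toL2‖ ≤ ‖u‖ :=
  WithLp.norm_fst_le (p := 2) _ u.1

theorem norm_toH1_le {Ω : Set (Space d)} (u : H2 Ω) : ‖u.toH1‖ ≤ ‖u‖ :=
  WithLp.norm_fst_le (p := 2) _ u.1

theorem integrable_sq_of_hasCompactSupport {ζ : Space d → ℝ} (hζ : Continuous ζ)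
    (hc : HasCompactSupport ζ) : Integrable fun z => ζ z ^ 2 :=
  (memLp_two_iff_integrable_sq hζ.aestronglyMeasurable).1 (hζ.memLp_of_hasCompactSupport hc)

/-- A weight supported in the unit ball does not grow under multiplication by coordinates, so one
constant serves for `θ` and the weights of both derivatives. -/
theorem sqrt_integral_coordMul_sq_le (i : Fin d) {ζ : Space d → ℝ} (hζ : Continuous ζ)
    (hc : HasCompactSupport ζ) (h1 : ∀ z ∈ tsupport ζ, ‖z‖ ≤ 1) :
    √(∫ z, coordMul i ζ z ^ 2) ≤ √(∫ z, ζ z ^ 2) := by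
  refine Real.sqrt_le_sqrt (integral_mono (integrable_sq_of_hasCompactSupport
    (continuous_coordMul i hζ) (hasCompactSupport_coordMul i hc))
    (integrable_sq_of_hasCompactSupport hζ hc) fun z => ?_)
  by_cases hz : z ∈ tsupport ζ
  · have hz1 : |z i| ≤ 1 := by
      rw [← Real.norm_eq_abs]
      exact (PiLp.norm_apply_le z i).trans (h1 z hz)
    simp only [coordMul, mul_pow]
    exact mul_le_of_le_one_left (sq_nonneg _) ((sq_le_one_iff_abs_le_one _).2 hz1)
  · simp [coordMul, image_eq_zero_of_notMem_tsupport hz]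

theorem abs_weightedAverage_le_of_weakDeriv {Ω : Set (Space d)} (hd : d ≤ 3)
    (hb : Bornology.IsBounded Ω) {u : L2 Ω} {du : Fin d → L2 Ω} {ddu : Fin d → Fin d → L2 Ω} {M : ℝ} (hM : 0 ≤ M)
    (hu : ∀ i, IsWeakDeriv Ω i u (du i)) (hdu : ∀ i j, IsWeakDeriv Ω j (du i) (ddu i j))
    (hMu : ‖u‖ ≤ M) (hMdu : ∀ i, ‖du i‖ ≤ M) (hMddu : ∀ i j, ‖ddu i j‖ ≤ M)
    {θ : Space d → ℝ} (hθc : ContDiff ℝ ∞ θ) (hcs : HasCompactSupport θ)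
    (hR : ∀ z ∈ tsupport θ, ‖z‖ ≤ 1) {x : Space d}
    (hin : ∀ ε ∈ Ioc (0 : ℝ) 1, ∀ z ∈ tsupport θ, x + ε • z ∈ Ω) :
    ∀ ε ∈ Ioc (0 : ℝ) 1, |weightedAverage u θ x ε| ≤
      √(∫ z, θ z ^ 2) * (1 + d + 4 * (d * d)) * M := by
  obtain ⟨N, hN⟩ : ∃ N, N = √(∫ z, θ z ^ 2) := ⟨_, rfl⟩
  have hN0 : 0 ≤ N := hN ▸ Real.sqrt_nonneg _
  rw [← hN]
  have hθi : ∀ i, √(∫ z, coordMul i θ z ^ 2) ≤ N := fun i =>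
    (sqrt_integral_coordMul_sq_le i hθc.continuous hcs hR).trans hN.ge
  have hθij : ∀ i j, √(∫ z, coordMul j (coordMul i θ) z ^ 2) ≤ N := fun i j =>
    (sqrt_integral_coordMul_sq_le j (continuous_coordMul i hθc.continuous)
      (hasCompactSupport_coordMul i hcs)
      fun z hz => hR z (tsupport_coordMul_subset i θ hz)).trans (hθi i)
  have hD1 : ∀ i, ∀ ε ∈ Ioc (0 : ℝ) 1, |weightedAverage (du i) (coordMul i θ) x ε| ≤
      M * N * (ε * √ε)⁻¹ := by
    intro i ε hε
    refine (abs_weightedAverage_le hd _ (contDiff_coordMul i hθc).continuous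
      (hasCompactSupport_coordMul i hcs) x hε.1 hε.2).trans ?_
    have := hε.1.le
    gcongr
    · exact hMdu i
    · exact hθi i
  have hD2 : ∀ i j, ∀ ε ∈ Ioc (0 : ℝ) 1,
      |weightedAverage (ddu i j) (coordMul j (coordMul i θ)) x ε| ≤
      M * N * (ε * √ε)⁻¹ := by
    intro i j ε hε
    refine (abs_weightedAverage_le hd _ (contDiff_coordMul j (contDiff_coordMul i hθc)).continuous
      (hasCompactSupport_coordMul j (hasCompactSupport_coordMul i hcs)) x hε.1 hε.2).trans ?_
    have := hε.1.le
    gcongr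
    · exact hMddu i j
    · exact hθij i j
  have hD0 : |weightedAverage u θ x 1| ≤ M * N := by
    refine (abs_weightedAverage_le hd _ hθc.continuous hcs x one_pos le_rfl).trans ?_
    rw [← hN, Real.sqrt_one, mul_one, inv_one, mul_one]
    gcongr
  intro ε hε
  have hmain := abs_le_of_abs_second_deriv_le (h := weightedAverage u θ x)
    (h' := fun ε => ∑ i, weightedAverage (du i) (coordMul i θ) x ε)
    (h'' := fun ε => ∑ i, ∑ j, weightedAverage (ddu i j) (coordMul j (coordMul i θ)) x ε)
    (B := d * d * (M * N)) (by positivity)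
    (fun ε hε => hasDerivAt_weightedAverage hb hu hθc hcs hε.1 (hin ε hε))
    (fun ε hε => HasDerivAt.fun_sum fun i _ => hasDerivAt_weightedAverage hb
      (hdu i) (contDiff_coordMul i hθc) (hasCompactSupport_coordMul i hcs) hε.1
      fun z hz => hin ε hε z (tsupport_coordMul_subset i θ hz))
    (fun ε hε => by
      refine (Finset.abs_sum_le_sum_abs _ _).trans ?_
      refine (Finset.sum_le_sum fun i _ => (Finset.abs_sum_le_sum_abs _ _).trans
        (Finset.sum_le_sum fun j _ => hD2 i j ε hε)).trans (le_of_eq ?_)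
      simp only [Finset.sum_const, Finset.card_univ, Fintype.card_fin, nsmul_eq_mul]
      ring) hε
  have h1 : |∑ i, weightedAverage (du i) (coordMul i θ) x 1| ≤ d * (M * N) := by
    refine (Finset.abs_sum_le_sum_abs _ _).trans ((Finset.sum_le_sum fun i _ =>
      hD1 i 1 ⟨one_pos, le_rfl⟩).trans (le_of_eq ?_))
    simp
  calc _ ≤ _ := hmain
    _ ≤ M * N + d * (M * N) + 4 * (d * d * (M * N)) := by gcongr
    _ = _ := by ring

/-- The embedding `H²(Ω) ⊂ L^∞(Ω)` in dimension at most three. -/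
theorem exists_bound_of_weakDeriv {Ω : Set (Space d)} (hd : d ≤ 3) (hΩ : IsRegularDomain Ω) :
    ∃ C, 0 ≤ C ∧ ∀ (u : L2 Ω) (du : Fin d → L2 Ω) (ddu : Fin d → Fin d → L2 Ω) (M : ℝ), 0 ≤ M →
      (∀ i, IsWeakDeriv Ω i u (du i)) → (∀ i j, IsWeakDeriv Ω j (du i) (ddu i j)) →
      ‖u‖ ≤ M → (∀ i, ‖du i‖ ≤ M) → (∀ i j, ‖ddu i j‖ ≤ M) →
      ∀ᵐ x ∂(volume.restrict Ω), |u x| ≤ C * M := by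
  obtain ⟨r, hr, κ, hκ0, hκ1, hcone⟩ := hΩ.cone
  -- The ball of radius `δ` about `ρ v` must lie in the cone and in the unit ball. Its points
  -- satisfy `‖z‖ ≤ ρ + δ < 2ρ ≤ min r 1` and `⟪z, v⟫ ≥ ρ - δ`, and `κ (ρ + δ) < ρ - δ` holds
  -- because `δ (1 + κ) < ρ (1 - κ)`.
  set ρ := min r 1 / 2 with hρ
  have hρ0 : 0 < ρ := by positivity
  have hρr : 2 * ρ ≤ r := by rw [hρ]; linarith [min_le_left r 1]
  have hρ1 : 2 * ρ ≤ 1 := by rw [hρ]; linarith [min_le_right r 1]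
  set δ := ρ * (1 - κ) / 4 with hδ
  have hδ0 : 0 < δ := by have := sub_pos.2 hκ1; positivity
  have hδρ : ρ + δ < 2 * ρ := by rw [hδ]; nlinarith
  have hκδ : κ * (ρ + δ) < ρ - δ := by
    have h := mul_pos hρ0 (sub_pos.2 hκ1)
    rw [hδ]
    nlinarith [mul_pos h (sub_pos.2 hκ1)]
  let Θ₀ : ContDiffBump (0 : Space d) := ⟨δ / 2, δ, half_pos hδ0, half_lt_self hδ0⟩
  set Θ : Space d → ℝ := Θ₀.normed volume with hΘ
  set N := √(∫ z, Θ z ^ 2) with hN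
  refine ⟨N * (1 + d + 4 * (d * d)), by positivity, fun u du ddu M hM hu hdu hMu hMdu hMddu => ?_⟩
  filter_upwards [ae_tendsto_weightedAverage hΩ.isBounded hΩ.isOpen.measurableSet u hδ0 (ρ / δ),
    ae_restrict_mem hΩ.isOpen.measurableSet] with x hlim hxΩ
  obtain ⟨v, hv1, hv⟩ := hcone x hxΩ
  -- A translate of one fixed bump: only its centre depends on `x`, so its `L²` norm `N` does not.
  set θ : Space d → ℝ := fun z => Θ (z - ρ • v) with hθ
  have hθc : ContDiff ℝ ∞ θ := Θ₀.contDiff_normed.comp (contDiff_id.sub contDiff_const)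
  have hnv : ‖ρ • v‖ = ρ := by rw [norm_smul, hv1, mul_one, Real.norm_of_nonneg hρ0.le]
  have hts : tsupport θ ⊆ Metric.closedBall (ρ • v) δ := by
    refine closure_minimal (fun z hz => ?_) Metric.isClosed_closedBall
    have h1 : z - ρ • v ∈ Function.support (Θ₀.normed volume) := hz
    rw [ContDiffBump.support_normed_eq, Metric.mem_ball, dist_zero_right] at h1
    rw [Metric.mem_closedBall, dist_eq_norm]
    exact h1.le
  have hcs : HasCompactSupport θ :=
    (isCompact_closedBall (ρ • v) δ).of_isClosed_subset (isClosed_tsupport _) hts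
  have hnorm : ∀ z ∈ Metric.closedBall (ρ • v) δ, ‖z‖ ≤ ρ + δ := by
    intro z hz
    rw [Metric.mem_closedBall, dist_eq_norm] at hz
    calc ‖z‖ = ‖ρ • v + (z - ρ • v)‖ := by rw [add_sub_cancel]
      _ ≤ _ := (norm_add_le _ _).trans (add_le_add hnv.le hz)
  have hin : ∀ ε ∈ Ioc (0 : ℝ) 1, ∀ z ∈ tsupport θ, x + ε • z ∈ Ω := by
    intro ε hε z hz
    have hz1 := hnorm z (hts hz)
    have hz2 := hts hz
    rw [Metric.mem_closedBall, dist_eq_norm] at hz2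
    have hz3 : ρ - δ ≤ inner ℝ z v := by
      have e : inner ℝ z v = ρ + inner ℝ (z - ρ • v) v := by
        rw [inner_sub_left, real_inner_smul_left, real_inner_self_eq_norm_sq, hv1]; ring
      have := abs_real_inner_le_norm (z - ρ • v) v
      rw [hv1, mul_one] at this
      rw [e]
      linarith [(abs_le.1 (this.trans hz2)).1]
    refine hv _ ?_ ?_
    · rw [norm_smul, Real.norm_of_nonneg hε.1.le]
      nlinarith [hε.2, norm_nonneg z]
    · rw [norm_smul, Real.norm_of_nonneg hε.1.le, real_inner_smul_left]
      have : κ * ‖z‖ < inner ℝ z v := by nlinarith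
      rw [mul_left_comm]
      exact mul_lt_mul_of_pos_left this hε.1
  have hθ1 : ∫ z, θ z = 1 := by
    rw [hθ, integral_sub_right_eq_self Θ]
    exact Θ₀.integral_normed
  have hθN : √(∫ z, θ z ^ 2) = N := by
    rw [hθ, integral_sub_right_eq_self (fun z => Θ z ^ 2)]
  have hR : ∀ z ∈ tsupport θ, ‖z‖ ≤ 1 := fun z hz => (hnorm z (hts hz)).trans (by linarith)
  have hbound := abs_weightedAverage_le_of_weakDeriv hd hΩ.isBounded hM hu hdu hMu hMdu
    hMddu hθc hcs hR hin
  rw [hθN] at hbound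
  have ht := (hlim (ρ • v) θ (by rw [hnv]; field_simp; exact le_rfl) hθc.continuous
    ((subset_tsupport _).trans hts) hθ1).abs
  refine le_of_tendsto ht ?_
  filter_upwards [Ioc_mem_nhdsGT one_pos] with ε hε using hbound ε hε

theorem exists_sobolev_bound {Ω : Set (Space d)} (hd : d ≤ 3) (hΩ : IsRegularDomain Ω) :
    ∃ C, 0 ≤ C ∧ ∀ u : H2 Ω, ∀ᵐ x ∂(volume.restrict Ω), |u.toL2 x| ≤ C * ‖u‖ := by
  obtain ⟨C, hC, h⟩ := exists_bound_of_weakDeriv hd hΩ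
  exact ⟨C, hC, fun u => h u.toL2 u.toH1.grad (fun i j => u.1.snd (i, j)) ‖u‖ (norm_nonneg _)
    u.toH1.2 u.2 ((norm_toL2_le _).trans (norm_toH1_le u))
    (fun i => (norm_grad_le _ i).trans (norm_toH1_le u))
    fun i j => (PiLp.norm_apply_le u.1.snd (i, j)).trans (WithLp.norm_snd_le (p := 2) _ u.1)⟩

/-! ### The pointwise dissipation inequality -/

/-- The pointwise estimate behind the dissipation inequality. -/
theorem dissipation_estimate {b b₁ b₂ b₃ m p u n q₁ q₂ C₂ C₃ C₄ : ℝ} (hb₁ : 0 < b₁) (h1 : b₁ ≤ b)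
    (h2 : b ≤ b₂) (hb₃ : 0 ≤ b₃) (hp : p ^ 2 ≤ b₃ ^ 2 * (n ^ 2 * u ^ 2))
    (hC₂ : C₂ = 1 / 2 + 3 / b₁) (hC₃ : C₃ = 1 + 3 * b₂)
    (hC₄ : C₄ = b₃ ^ 2 + 6 * b₃ ^ 2 / b₁ ∨ (b₁ ≤ 10 ∧ C₄ = b₃ + 6 * b₃ ^ 2 / b₁ ^ 2)) :
    (m + q₂) * (-b * m - p - q₁) + 1 / 2 * (b * m ^ 2) ≤
      C₄ * (n ^ 2 * u ^ 2) + C₂ * q₁ ^ 2 + C₃ * q₂ ^ 2 := by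
  have hb : 0 < b := hb₁.trans_le h1
  -- The left side is a concave quadratic in `m`, and the right side is its maximum.
  have hmax : (m + q₂) * (-b * m - p - q₁) + 1 / 2 * (b * m ^ 2) ≤
      (p + q₁) ^ 2 / (2 * b) + b * q₂ ^ 2 / 2 := by
    have : (p + q₁) ^ 2 / (2 * b) + b * q₂ ^ 2 / 2 -
        ((m + q₂) * (-b * m - p - q₁) + 1 / 2 * (b * m ^ 2)) =
        (b * m + p + q₁ + b * q₂) ^ 2 / (2 * b) := by
      field_simp
      ring
    have h0 : 0 ≤ (b * m + p + q₁ + b * q₂) ^ 2 / (2 * b) := by positivity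
    linarith
  have hq₂ : b * q₂ ^ 2 / 2 ≤ C₃ * q₂ ^ 2 := by
    rw [hC₃]; nlinarith [sq_nonneg q₂]
  have hmono : (p + q₁) ^ 2 / (2 * b) ≤ (p + q₁) ^ 2 / (2 * b₁) := by gcongr
  -- Young's inequality with weight `t = b₁ + 5`, the value for which the coefficient `(1 + t) / (2
  -- b₁)` of `q₁ ^ 2` is exactly `1 / 2 + 3 / b₁`.
  have hyoung : (p + q₁) ^ 2 / (2 * b₁) ≤
      (b₁ + 6) / (2 * b₁ * (b₁ + 5)) * p ^ 2 + C₂ * q₁ ^ 2 := by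
    rw [hC₂]
    have : (b₁ + 6) / (2 * b₁ * (b₁ + 5)) * p ^ 2 + (1 / 2 + 3 / b₁) * q₁ ^ 2 -
        (p + q₁) ^ 2 / (2 * b₁) = (p - (b₁ + 5) * q₁) ^ 2 / (2 * b₁ * (b₁ + 5)) := by
      field_simp
      ring
    have h0 : 0 ≤ (p - (b₁ + 5) * q₁) ^ 2 / (2 * b₁ * (b₁ + 5)) := by positivity
    linarith
  have hcoef : (b₁ + 6) / (2 * b₁ * (b₁ + 5)) * b₃ ^ 2 ≤ C₄ := by
    rcases hC₄ with h | ⟨h10, h⟩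
    · have : (b₁ + 6) / (2 * b₁ * (b₁ + 5)) ≤ 1 + 6 / b₁ := by
        rw [div_le_iff₀ (by positivity)]
        field_simp
        nlinarith [mul_pos hb₁ hb₁]
      rw [h]
      calc _ ≤ (1 + 6 / b₁) * b₃ ^ 2 := by gcongr
        _ = _ := by ring
    -- Clearing denominators leaves `b₁ (b₁ + 6) ≤ 12 (b₁ + 5)`, which `b₁ ≤ 10` guarantees.
    · have : (b₁ + 6) / (2 * b₁ * (b₁ + 5)) ≤ 6 / b₁ ^ 2 := by
        rw [div_le_div_iff₀ (by positivity) (by positivity)]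
        have : b₁ * (b₁ + 6) ≤ 12 * (b₁ + 5) := by nlinarith
        nlinarith
      rw [h]
      calc _ ≤ 6 / b₁ ^ 2 * b₃ ^ 2 := by gcongr
        _ ≤ b₃ + 6 / b₁ ^ 2 * b₃ ^ 2 := by linarith
        _ = _ := by ring
  have hlast : (b₁ + 6) / (2 * b₁ * (b₁ + 5)) * p ^ 2 ≤ C₄ * (n ^ 2 * u ^ 2) := by
    calc _ ≤ (b₁ + 6) / (2 * b₁ * (b₁ + 5)) * (b₃ ^ 2 * (n ^ 2 * u ^ 2)) := by gcongr
      _ = (b₁ + 6) / (2 * b₁ * (b₁ + 5)) * b₃ ^ 2 * (n ^ 2 * u ^ 2) := by ring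
      _ ≤ _ := by gcongr
  linarith

/-! ### Taylor estimates for the relative potential -/

theorem abs_sub_le_of_abs_deriv_le_Icc {g : ℝ → ℝ} (hg : Differentiable ℝ g) {K r : ℝ}
    (hK : ∀ s ∈ Icc (-r) r, |deriv g s| ≤ K) {a c : ℝ} (ha : a ∈ Icc (-r) r) (hc : c ∈ Icc (-r) r) :
    |g a - g c| ≤ K * |a - c| :=
  (convex_Icc (-r) r).norm_image_sub_le_of_norm_deriv_le (fun x _ => hg x) hK hc ha

/-- First order Taylor estimate for a function with bounded second derivative on an interval. -/
theorem abs_relPotential_le {g : ℝ → ℝ} (hg : ContDiff ℝ 2 g) {K r : ℝ}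
    (hK : ∀ s ∈ Icc (-r) r, |deriv (deriv g) s| ≤ K) {a c : ℝ} (ha : a ∈ Icc (-r) r)
    (hc : c ∈ Icc (-r) r) : |relPotential g a c| ≤ K * (a - c) ^ 2 := by
  have hg1 : Differentiable ℝ g := hg.differentiable (by simp)
  have hg2 : Differentiable ℝ (deriv g) := (hg.differentiable_deriv_two)
  have hsub : uIcc c a ⊆ Icc (-r) r := uIcc_subset_Icc hc ha
  have hK0 : 0 ≤ K := (abs_nonneg _).trans (hK c hc)
  -- The increment of `g s - g'(c) s` from `c` to `a` is the relative potential; its derivative is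
  -- at most `K |a - c|` between them. The factor `1/2` of Taylor's formula is given up.
  have hd : ∀ x, HasDerivAt (fun s => g s - deriv g c * s) (deriv g x - deriv g c) x := fun x => by
    exact ((hg1 x).hasDerivAt.fun_sub
      ((hasDerivAt_id' x).const_mul (deriv g c))).congr_deriv (by simp)
  have := (convex_uIcc c a).norm_image_sub_le_of_norm_hasDerivWithin_le
    (f := fun s => g s - deriv g c * s) (C := K * |a - c|)
    (fun x _ => (hd x).hasDerivWithinAt) (fun x hx => by
      refine (abs_sub_le_of_abs_deriv_le_Icc hg2 hK (hsub hx) hc).trans ?_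
      exact mul_le_mul_of_nonneg_left (abs_sub_left_of_mem_uIcc hx) hK0)
    left_mem_uIcc right_mem_uIcc
  rw [Real.norm_eq_abs, Real.norm_eq_abs, mul_assoc, ← sq, sq_abs] at this
  convert this using 2
  rw [relPotential]
  ring

/-- Bounds of a `C²` function on `[-M, M]`. -/
structure BoxBound (g : ℝ → ℝ) (M L : ℝ) : Prop where
  nonneg : 0 ≤ L
  lip : ∀ a ∈ Icc (-M) M, ∀ c ∈ Icc (-M) M, |g a - g c| ≤ L * |a - c|
  lip_deriv : ∀ a ∈ Icc (-M) M, ∀ c ∈ Icc (-M) M, |deriv g a - deriv g c| ≤ L * |a - c|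
  deriv_le : ∀ c ∈ Icc (-M) M, |deriv g c| ≤ L
  rel_le : ∀ a ∈ Icc (-M) M, ∀ c ∈ Icc (-M) M, |relPotential g a c| ≤ L * (a - c) ^ 2

theorem BoxBound.mono {g : ℝ → ℝ} {M L L' : ℝ} (h : BoxBound g M L) (hL : L ≤ L') :
    BoxBound g M L' where
  nonneg := h.nonneg.trans hL
  lip a ha c hc := (h.lip a ha c hc).trans (mul_le_mul_of_nonneg_right hL (abs_nonneg _))
  lip_deriv a ha c hc :=
    (h.lip_deriv a ha c hc).trans (mul_le_mul_of_nonneg_right hL (abs_nonneg _))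
  deriv_le c hc := (h.deriv_le c hc).trans hL
  rel_le a ha c hc := (h.rel_le a ha c hc).trans (mul_le_mul_of_nonneg_right hL (sq_nonneg _))

theorem exists_boxBound {g : ℝ → ℝ} (hg : ContDiff ℝ 2 g) (M : ℝ) : ∃ L, BoxBound g M L := by
  have hg1 : Differentiable ℝ g := hg.differentiable (by simp)
  have hg2 : Differentiable ℝ (deriv g) := (hg.differentiable_deriv_two)
  have hc1 : Continuous (deriv g) := hg2.continuous
  have hc2 : Continuous (deriv (deriv g)) := by
    have := hg.continuous_iteratedDeriv 2 le_rfl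
    rwa [iteratedDeriv_succ, iteratedDeriv_one] at this
  obtain ⟨K1, hK1⟩ := isCompact_Icc.exists_bound_of_continuousOn (s := Icc (-M) M) hc1.continuousOn
  obtain ⟨K2, hK2⟩ := isCompact_Icc.exists_bound_of_continuousOn (s := Icc (-M) M) hc2.continuousOn
  have h1 : ∀ s ∈ Icc (-M) M, |deriv g s| ≤ max 0 (max K1 K2) := fun s hs =>
    (hK1 s hs).trans ((le_max_left _ _).trans (le_max_right _ _))
  have h2 : ∀ s ∈ Icc (-M) M, |deriv (deriv g) s| ≤ max 0 (max K1 K2) := fun s hs =>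
    (hK2 s hs).trans ((le_max_right _ _).trans (le_max_right _ _))
  exact ⟨max 0 (max K1 K2), le_max_left _ _,
    fun a ha c hc => abs_sub_le_of_abs_deriv_le_Icc hg1 h1 ha hc,
    fun a ha c hc => abs_sub_le_of_abs_deriv_le_Icc hg2 h2 ha hc, h1,
    fun a ha c hc => abs_relPotential_le hg h2 ha hc⟩

/-- Supplies the Lipschitz hypothesis of `exists_superposition` for the relative potentials of both
`f` and `f'`. -/
theorem BoxBound.abs_relPotential_sub_le {g : ℝ → ℝ} {M L : ℝ} (h : BoxBound g M L) {a c a' c' : ℝ}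
    (ha : a ∈ Icc (-M) M) (hc : c ∈ Icc (-M) M) (ha' : a' ∈ Icc (-M) M) (hc' : c' ∈ Icc (-M) M) :
    |relPotential g a' c' - relPotential g a c| ≤
      (2 * L + 2 * M * L) * (|a' - a| + |c' - c|) := by
  have e : relPotential g a' c' - relPotential g a c = (g a' - g a) - (g c' - g c)
      - deriv g c' * ((a' - a) - (c' - c)) - (deriv g c' - deriv g c) * (a - c) := by
    simp only [relPotential]; ring
  have hac : |a - c| ≤ 2 * M :=
    abs_sub_le_iff.2 ⟨by linarith [ha.2, hc.1], by linarith [ha.1, hc.2]⟩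
  have hL := h.nonneg
  have h3 : |deriv g c' * ((a' - a) - (c' - c))| ≤ L * (|a' - a| + |c' - c|) := by
    rw [abs_mul]
    exact mul_le_mul (h.deriv_le c' hc') (abs_sub _ _) (abs_nonneg _) hL
  have h4 : |(deriv g c' - deriv g c) * (a - c)| ≤ L * |c' - c| * (2 * M) := by
    rw [abs_mul]
    exact mul_le_mul (h.lip_deriv _ hc' _ hc) hac (abs_nonneg _) (by positivity)
  rw [e]
  calc _ ≤ |g a' - g a| + |g c' - g c| + |deriv g c' * ((a' - a) - (c' - c))|
        + |(deriv g c' - deriv g c) * (a - c)| := by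
        refine (abs_sub _ _).trans (add_le_add_left ((abs_sub _ _).trans
          (add_le_add_left (abs_sub _ _) _)) _)
    _ ≤ L * |a' - a| + L * |c' - c| + L * (|a' - a| + |c' - c|) + L * |c' - c| * (2 * M) := by
        gcongr
        · exact h.lip _ ha' _ ha
        · exact h.lip _ hc' _ hc
    _ ≤ _ := by
        have hM : 0 ≤ M := by linarith [ha.1, ha.2]
        have : 0 ≤ 2 * M * L * |a' - a| := by positivity
        nlinarith

/-- The subtracted terms are the differential of `(a, c) ↦ f(a|c)` at `(a, c)`. The remainder
regroups into relative potentials of increments in one variable and a product of two increments, all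
quadratic. -/
theorem abs_relPotential_increment_le {f : ℝ → ℝ} {M L : ℝ} (h : BoxBound f M L)
    (h' : BoxBound (deriv f) M L) {a c a' c' : ℝ} (ha : a ∈ Icc (-M) M) (hc : c ∈ Icc (-M) M)
    (ha' : a' ∈ Icc (-M) M) (hc' : c' ∈ Icc (-M) M) :
    |relPotential f a' c' - relPotential f a c - (deriv f a - deriv f c) * ((a' - a) - (c' - c))
      - relPotential (deriv f) a c * (c' - c)| ≤
      (3 * L + 2 * M * L) * ((a' - a) ^ 2 + (c' - c) ^ 2) := by
  have e : relPotential f a' c' - relPotential f a c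
      - (deriv f a - deriv f c) * ((a' - a) - (c' - c)) - relPotential (deriv f) a c * (c' - c) =
      relPotential f a' a - relPotential f c' c - relPotential (deriv f) c' c * (a' - c')
      - deriv (deriv f) c * ((c' - c) * ((a' - a) - (c' - c))) := by
    simp only [relPotential]; ring
  have hL := h.nonneg
  have hM : 0 ≤ M := by linarith [ha.1, ha.2]
  have hac : |a' - c'| ≤ 2 * M :=
    abs_sub_le_iff.2 ⟨by linarith [ha'.2, hc'.1], by linarith [ha'.1, hc'.2]⟩
  have h3 : |relPotential (deriv f) c' c * (a' - c')| ≤ L * (c' - c) ^ 2 * (2 * M) := by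
    rw [abs_mul]
    exact mul_le_mul (h'.rel_le _ hc' _ hc) hac (abs_nonneg _) (by positivity)
  have h4 : |deriv (deriv f) c * ((c' - c) * ((a' - a) - (c' - c)))| ≤
      L * (2 * ((a' - a) ^ 2 + (c' - c) ^ 2)) := by
    rw [abs_mul]
    refine mul_le_mul (h'.deriv_le c hc) ?_ (abs_nonneg _) hL
    rw [abs_le]
    constructor <;> nlinarith [sq_nonneg ((a' - a) - (c' - c)), sq_nonneg ((a' - a) + (c' - c)),
      sq_nonneg (a' - a), sq_nonneg (c' - c)]
  rw [e]
  calc _ ≤ |relPotential f a' a| + |relPotential f c' c| + |relPotential (deriv f) c' c * (a' - c')|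
        + |deriv (deriv f) c * ((c' - c) * ((a' - a) - (c' - c)))| := by
        refine (abs_sub _ _).trans (add_le_add_left ((abs_sub _ _).trans
          (add_le_add_left (abs_sub _ _) _)) _)
    _ ≤ L * (a' - a) ^ 2 + L * (c' - c) ^ 2 + L * (c' - c) ^ 2 * (2 * M)
        + L * (2 * ((a' - a) ^ 2 + (c' - c) ^ 2)) := by
        gcongr
        · exact h.rel_le _ ha' _ ha
        · exact h.rel_le _ hc' _ hc
    _ ≤ _ := by
        have : 0 ≤ 2 * M * L * (a' - a) ^ 2 := by positivity
        nlinarith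

/-- Trapezoidal rule for increments of the relative potential. -/
theorem abs_relPotential_trapezoid_le {f : ℝ → ℝ} {M L : ℝ} (h : BoxBound f M L)
    (h' : BoxBound (deriv f) M L) {a c a' c' : ℝ} (ha : a ∈ Icc (-M) M) (hc : c ∈ Icc (-M) M)
    (ha' : a' ∈ Icc (-M) M) (hc' : c' ∈ Icc (-M) M) :
    |relPotential f a' c' - relPotential f a c
      - 1 / 2 * (((a' - c') - (a - c)) * ((deriv f a' - deriv f c') + (deriv f a - deriv f c)))
      - 1 / 2 * ((c' - c) * (relPotential (deriv f) a' c' + relPotential (deriv f) a c))| ≤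
      3 * (3 * L + 2 * M * L) * (((a' - c') - (a - c)) ^ 2 + (c' - c) ^ 2) := by
  -- The trapezoidal rule is half the difference of the one-sided expansions at the two endpoints.
  have h1 := abs_relPotential_increment_le h h' ha hc ha' hc'
  have h2 := abs_relPotential_increment_le h h' ha' hc' ha hc
  have hL := h.nonneg
  have hM : 0 ≤ M := by linarith [ha.1, ha.2]
  have hK : 0 ≤ 3 * L + 2 * M * L := by positivity
  -- The error is passed to the variables `a - c` and `c`; the factor 3 comes from `(X + Y)² + Y² ≤
  -- 3 (X² + Y²)`.
  have h3 : (a' - a) ^ 2 + (c' - c) ^ 2 ≤ 3 * (((a' - c') - (a - c)) ^ 2 + (c' - c) ^ 2) := by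
    nlinarith [sq_nonneg (((a' - c') - (a - c)) - (c' - c)), sq_nonneg ((a' - c') - (a - c))]
  have h4 := mul_le_mul_of_nonneg_left h3 hK
  have e2 : (a - a') ^ 2 + (c - c') ^ 2 = (a' - a) ^ 2 + (c' - c) ^ 2 := by ring
  rw [e2] at h2
  rw [abs_le] at h1 h2 ⊢
  constructor <;> linarith

/-! ### Superposition operators -/

/-- Superposition operators of locally Lipschitz functions preserve measurability in time. -/
theorem exists_superposition {α : Type*} [MeasurableSpace α] {ν : Measure α} [IsFiniteMeasure ν]
    {τ : Measure ℝ} {M K : ℝ} (hM : 0 ≤ M) (hK : 0 ≤ K) {Φ : ℝ → ℝ → ℝ}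
    (hΦ : ∀ a ∈ Icc (-M) M, ∀ c ∈ Icc (-M) M, ∀ a' ∈ Icc (-M) M, ∀ c' ∈ Icc (-M) M,
      |Φ a' c' - Φ a c| ≤ K * (|a' - a| + |c' - c|))
    {u w : ℝ → Lp ℝ 2 ν} (hu : AEStronglyMeasurable u τ) (hw : AEStronglyMeasurable w τ) :
    ∃ N : ℝ → Lp ℝ 2 ν, AEStronglyMeasurable N τ ∧ (∃ B, ∀ t, ‖N t‖ ≤ B) ∧
      ∀ t, (∀ᵐ x ∂ν, u t x ∈ Icc (-M) M) → (∀ᵐ x ∂ν, w t x ∈ Icc (-M) M) →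
        N t =ᵐ[ν] fun x => Φ (u t x) (w t x) := by
  have hMM : -M ≤ M := by linarith
  -- Truncating the arguments to the box makes `Φ` globally Lipschitz and bounded, so it induces a
  -- continuous map on all of `L² × L²`. Truncation changes nothing when the functions take values
  -- in the box.
  set Ψ : ℝ × ℝ → ℝ := fun p => Φ (projIcc (-M) M hMM p.1) (projIcc (-M) M hMM p.2) with hΨ
  have hcl : ∀ a a' : ℝ, |(projIcc (-M) M hMM a' : ℝ) - projIcc (-M) M hMM a| ≤ |a' - a| :=
    fun a a' => by
      have := (LipschitzWith.projIcc hMM).dist_le_mul a' a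
      simpa [Subtype.dist_eq, Real.dist_eq] using this
  have hΨl : ∀ p q : ℝ × ℝ, |Ψ q - Ψ p| ≤ K * (|q.1 - p.1| + |q.2 - p.2|) := by
    intro p q
    refine (hΦ _ (projIcc _ _ hMM p.1).2 _ (projIcc _ _ hMM p.2).2 _ (projIcc _ _ hMM q.1).2 _
      (projIcc _ _ hMM q.2).2).trans ?_
    exact mul_le_mul_of_nonneg_left (add_le_add (hcl _ _) (hcl _ _)) hK
  have hΨc : Continuous Ψ := by
    rw [continuous_iff_continuousAt]
    intro p
    rw [ContinuousAt, tendsto_iff_dist_tendsto_zero]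
    have : Tendsto (fun q : ℝ × ℝ => K * (|q.1 - p.1| + |q.2 - p.2|)) (𝓝 p) (𝓝 0) := by
      have h : Continuous fun q : ℝ × ℝ => K * (|q.1 - p.1| + |q.2 - p.2|) := by fun_prop
      simpa using h.tendsto p
    exact squeeze_zero (fun q => dist_nonneg) (fun q => hΨl p q) this
  obtain ⟨B, hB⟩ : ∃ B, ∀ p, |Ψ p| ≤ B := by
    refine ⟨|Φ 0 0| + K * (M + M), fun p => ?_⟩
    have h0 : (0 : ℝ) ∈ Icc (-M) M := ⟨by linarith, hM⟩
    have h1 := hΦ 0 h0 0 h0 _ (projIcc _ _ hMM p.1).2 _ (projIcc _ _ hMM p.2).2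
    have h2 : ∀ y ∈ Icc (-M) M, |y - 0| ≤ M := fun y hy => by
      rw [sub_zero, abs_le]; exact hy
    calc |Ψ p| = |Φ 0 0 + (Ψ p - Φ 0 0)| := by rw [add_sub_cancel]
      _ ≤ |Φ 0 0| + |Ψ p - Φ 0 0| := abs_add_le _ _
      _ ≤ _ := by
        refine add_le_add_right (h1.trans ?_) _
        gcongr
        · exact h2 _ (projIcc _ _ hMM p.1).2
        · exact h2 _ (projIcc _ _ hMM p.2).2
  have hmem : ∀ p : Lp ℝ 2 ν × Lp ℝ 2 ν, MemLp (fun x => Ψ (p.1 x, p.2 x)) 2 ν := fun p =>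
    MemLp.of_bound (hΨc.comp_aestronglyMeasurable
      ((Lp.aestronglyMeasurable p.1).prodMk (Lp.aestronglyMeasurable p.2))) B
      (ae_of_all _ fun x => hB _)
  set nem : Lp ℝ 2 ν × Lp ℝ 2 ν → Lp ℝ 2 ν := fun p => (hmem p).toLp with hnem
  have hnem_eq : ∀ p, nem p =ᵐ[ν] fun x => Ψ (p.1 x, p.2 x) := fun p => (hmem p).coeFn_toLp
  have hnl : ∀ p q, ‖nem q - nem p‖ ≤ K * (‖q.1 - p.1‖ + ‖q.2 - p.2‖) := by
    intro p q
    have h1 : ‖nem q - nem p‖ ≤ ‖K • (|q.1 - p.1| + |q.2 - p.2|)‖ := by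
      refine Lp.norm_le_norm_of_ae_le ?_
      filter_upwards [Lp.coeFn_sub (nem q) (nem p), hnem_eq p, hnem_eq q,
        Lp.coeFn_smul K (|q.1 - p.1| + |q.2 - p.2|), Lp.coeFn_add |q.1 - p.1| |q.2 - p.2|,
        Lp.coeFn_abs (q.1 - p.1), Lp.coeFn_abs (q.2 - p.2), Lp.coeFn_sub q.1 p.1,
        Lp.coeFn_sub q.2 p.2] with x e1 e2 e3 e4 e5 e6 e7 e8 e9
      rw [e1, e4, Pi.sub_apply, Pi.smul_apply, e5, Pi.add_apply, e6, e7, e8, e9, e2, e3]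
      exact (hΨl _ _).trans (le_abs_self _)
    refine h1.trans ?_
    rw [norm_smul, Real.norm_of_nonneg hK]
    gcongr
    refine (norm_add_le _ _).trans ?_
    rw [norm_abs_eq_norm, norm_abs_eq_norm]
  have hnc : Continuous nem := by
    rw [continuous_iff_continuousAt]
    intro p
    rw [ContinuousAt, tendsto_iff_norm_sub_tendsto_zero]
    have : Tendsto (fun q : Lp ℝ 2 ν × Lp ℝ 2 ν => K * (‖q.1 - p.1‖ + ‖q.2 - p.2‖)) (𝓝 p)
        (𝓝 0) := by
      have h : Continuous fun q : Lp ℝ 2 ν × Lp ℝ 2 ν => K * (‖q.1 - p.1‖ + ‖q.2 - p.2‖) := by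
        fun_prop
      simpa using h.tendsto p
    exact squeeze_zero (fun q => norm_nonneg _) (fun q => hnl p q) this
  refine ⟨fun t => nem (u t, w t), hnc.comp_aestronglyMeasurable (hu.prodMk hw),
    ⟨_, fun t => Lp.norm_le_of_ae_bound (C := B) ((abs_nonneg _).trans (hB 0)) ?_⟩, ?_⟩
  · filter_upwards [hnem_eq (u t, w t)] with x hx
    rw [hx]
    exact hB _
  · intro t h1 h2
    filter_upwards [hnem_eq (u t, w t), h1, h2] with x hx hx1 hx2
    rw [hx]
    simp only [hΨ]
    rw [projIcc_of_mem hMM hx1, projIcc_of_mem hMM hx2]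

/-! ### Continuity of the embeddings and `L²` identities -/

theorem continuous_toL2 {Ω : Set (Space d)} : Continuous (H1.toL2 : H1 Ω → L2 Ω) :=
  (LipschitzWith.of_dist_le_mul (K := 1) fun u v => by
    rw [dist_eq_norm, dist_eq_norm, NNReal.coe_one, one_mul]
    exact norm_toL2_le (u - v)).continuous

theorem continuous_grad {Ω : Set (Space d)} (i : Fin d) :
    Continuous fun u : H1 Ω => u.grad i :=
  (LipschitzWith.of_dist_le_mul (K := 1) fun u v => by
    rw [dist_eq_norm, dist_eq_norm, NNReal.coe_one, one_mul]
    exact norm_grad_le (u - v) i).continuous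

theorem continuous_toH1 {Ω : Set (Space d)} : Continuous (H2.toH1 : H2 Ω → H1 Ω) :=
  (LipschitzWith.of_dist_le_mul (K := 1) fun u v => by
    rw [dist_eq_norm, dist_eq_norm, NNReal.coe_one, one_mul]
    exact norm_toH1_le (u - v)).continuous

theorem inner_eq_integral_mul {α : Type*} [MeasurableSpace α] {ν : Measure α} (f g : Lp ℝ 2 ν) :
    inner ℝ f g = ∫ x, f x * g x ∂ν := by
  rw [L2.inner_def]
  congr 1
  funext x
  simp [mul_comm]

theorem integrable_mul_L2 {α : Type*} [MeasurableSpace α] {ν : Measure α} (f g : Lp ℝ 2 ν) :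
    Integrable (fun x => f x * g x) ν :=
  MemLp.integrable_mul (p := 2) (q := 2) (Lp.memLp f) (Lp.memLp g)

theorem norm_sq_eq_integral {α : Type*} [MeasurableSpace α] {ν : Measure α} (f : Lp ℝ 2 ν) :
    ‖f‖ ^ 2 = ∫ x, f x ^ 2 ∂ν := by
  rw [← real_inner_self_eq_norm_sq, inner_eq_integral_mul]
  simp only [sq]

theorem integrable_sq_L2 {α : Type*} [MeasurableSpace α] {ν : Measure α} (f : Lp ℝ 2 ν) :
    Integrable (fun x => f x ^ 2) ν := by
  simpa only [sq] using integrable_mul_L2 f f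

theorem norm_sq_sub_norm_sq {X : Type*} [NormedAddCommGroup X] [InnerProductSpace ℝ X] (x y : X) :
    ‖x‖ ^ 2 - ‖y‖ ^ 2 = inner ℝ x (x - y) + inner ℝ y (x - y) := by
  rw [inner_sub_right, inner_sub_right, real_inner_self_eq_norm_sq, real_inner_self_eq_norm_sq,
    real_inner_comm]
  ring

/-- The inclusion `L^∞ ⊂ L²` over a finite measure. -/
def inclL2 {α : Type*} [MeasurableSpace α] {ν : Measure α} [IsFiniteMeasure ν] (n : Lp ℝ ∞ ν) :
    Lp ℝ 2 ν :=
  ((Lp.memLp n).mono_exponent le_top).toLp n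

theorem coeFn_inclL2 {α : Type*} [MeasurableSpace α] {ν : Measure α} [IsFiniteMeasure ν]
    (n : Lp ℝ ∞ ν) : inclL2 n =ᵐ[ν] n :=
  MemLp.coeFn_toLp _

theorem ae_abs_le_norm {α : Type*} [MeasurableSpace α] {ν : Measure α} (n : Lp ℝ ∞ ν) :
    ∀ᵐ x ∂ν, |n x| ≤ ‖n‖ := by
  have h := ae_le_eLpNormEssSup (f := n) (μ := ν)
  filter_upwards [h] with x hx
  rw [Lp.norm_def, eLpNorm_exponent_top, ← Real.norm_eq_abs, ← toReal_enorm]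
  refine ENNReal.toReal_mono ?_ hx
  have := Lp.eLpNorm_ne_top n
  rwa [eLpNorm_exponent_top] at this

theorem continuous_inclL2 {α : Type*} [MeasurableSpace α] {ν : Measure α} [IsFiniteMeasure ν] :
    Continuous (inclL2 : Lp ℝ ∞ ν → Lp ℝ 2 ν) := by
  rw [continuous_iff_continuousAt]
  intro n
  rw [ContinuousAt, tendsto_iff_norm_sub_tendsto_zero]
  have h0 : Tendsto (fun m : Lp ℝ ∞ ν => (measureUnivNNReal ν : ℝ) ^ (2 : ℝ≥0∞).toReal⁻¹ * ‖m - n‖)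
      (𝓝 n) (𝓝 0) := by
    have h : Continuous fun m : Lp ℝ ∞ ν =>
        (measureUnivNNReal ν : ℝ) ^ (2 : ℝ≥0∞).toReal⁻¹ * ‖m - n‖ := by fun_prop
    simpa using h.tendsto n
  refine squeeze_zero (fun m => norm_nonneg _) (fun m => ?_) h0
  refine Lp.norm_le_of_ae_bound (norm_nonneg _) ?_
  filter_upwards [Lp.coeFn_sub (inclL2 m) (inclL2 n), coeFn_inclL2 m, coeFn_inclL2 n,
    Lp.coeFn_sub m n, ae_abs_le_norm (m - n)] with x e1 e2 e3 e4 e5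
  rw [e1, Pi.sub_apply, e2, e3]
  rwa [e4] at e5

theorem ae_abs_le_supNorm {Ω : Set (Space d)} {u : L2 Ω} (hu : MemLp u ∞ (volume.restrict Ω)) :
    ∀ᵐ x ∂(volume.restrict Ω), |u x| ≤ supNorm u := by
  filter_upwards [ae_le_eLpNormEssSup (f := u) (μ := volume.restrict Ω)] with x hx
  rw [supNorm, eLpNorm_exponent_top, ← Real.norm_eq_abs, ← toReal_enorm]
  refine ENNReal.toReal_mono ?_ hx
  have := hu.eLpNorm_ne_top
  rwa [eLpNorm_exponent_top] at this

/-! ### Increments of the relative energy -/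

/-- Increment of the relative energy between two states that satisfy the equation for the chemical
potential. -/
theorem abs_relEnergy_increment_le {Ω : Set (Space d)} {γ : ℝ} (hγ : 0 < γ) {f : ℝ → ℝ} {M L : ℝ}
    (h : BoxBound f M L) (h' : BoxBound (deriv f) M L)
    {u u' w w' : H1 Ω} {G G' D D' R R' P P' : L2 Ω}
    (hu : ∀ᵐ x ∂(volume.restrict Ω), u.toL2 x ∈ Icc (-M) M)
    (hw : ∀ᵐ x ∂(volume.restrict Ω), w.toL2 x ∈ Icc (-M) M)
    (hu' : ∀ᵐ x ∂(volume.restrict Ω), u'.toL2 x ∈ Icc (-M) M)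
    (hw' : ∀ᵐ x ∂(volume.restrict Ω), w'.toL2 x ∈ Icc (-M) M)
    (hD : D =ᵐ[volume.restrict Ω] fun x => deriv f (u.toL2 x) - deriv f (w.toL2 x))
    (hD' : D' =ᵐ[volume.restrict Ω] fun x => deriv f (u'.toL2 x) - deriv f (w'.toL2 x))
    (hR : R =ᵐ[volume.restrict Ω] fun x => relPotential (deriv f) (u.toL2 x) (w.toL2 x))
    (hR' : R' =ᵐ[volume.restrict Ω] fun x => relPotential (deriv f) (u'.toL2 x) (w'.toL2 x))
    (hP : P =ᵐ[volume.restrict Ω] fun x => relPotential f (u.toL2 x) (w.toL2 x))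
    (hP' : P' =ᵐ[volume.restrict Ω] fun x => relPotential f (u'.toL2 x) (w'.toL2 x))
    (hPi : Integrable P (volume.restrict Ω)) (hPi' : Integrable P' (volume.restrict Ω))
    (hG : ∀ ξ : H1 Ω, inner ℝ G ξ.toL2 - ∑ i, inner ℝ (u.grad i - w.grad i) (ξ.grad i)
      - 1 / γ * inner ℝ D ξ.toL2 = 0)
    (hG' : ∀ ξ : H1 Ω, inner ℝ G' ξ.toL2 - ∑ i, inner ℝ (u'.grad i - w'.grad i) (ξ.grad i)
      - 1 / γ * inner ℝ D' ξ.toL2 = 0) :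
    |relEnergy γ f u' w' - relEnergy γ f u w
      - 1 / 2 * (inner ℝ ((u'.toL2 - w'.toL2) - (u.toL2 - w.toL2)) (G' + G)
        + inner ℝ (w'.toL2 - w.toL2) ((1 / γ) • R' + (1 / γ) • R))| ≤
      1 / γ * (3 * (3 * L + 2 * M * L)) *
        (‖(u'.toL2 - w'.toL2) - (u.toL2 - w.toL2)‖ ^ 2 + ‖w'.toL2 - w.toL2‖ ^ 2) := by
  set du : L2 Ω := (u'.toL2 - w'.toL2) - (u.toL2 - w.toL2) with hdu
  set dw : L2 Ω := w'.toL2 - w.toL2 with hdw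
  have hdue : du =ᵐ[volume.restrict Ω] fun x =>
      (u'.toL2 x - w'.toL2 x) - (u.toL2 x - w.toL2 x) := by
    filter_upwards [Lp.coeFn_sub (u'.toL2 - w'.toL2) (u.toL2 - w.toL2),
      Lp.coeFn_sub u'.toL2 w'.toL2, Lp.coeFn_sub u.toL2 w.toL2] with x e1 e2 e3
    rw [e1, Pi.sub_apply, e2, e3, Pi.sub_apply, Pi.sub_apply]
  have hdwe : dw =ᵐ[volume.restrict Ω] fun x => w'.toL2 x - w.toL2 x := Lp.coeFn_sub _ _
  have hE : relEnergy γ f u w =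
      1 / 2 * (∑ i, ‖u.grad i - w.grad i‖ ^ 2) + 1 / γ * ∫ x in Ω, P x := by
    rw [relEnergy, integral_const_mul]
    congr 2
    exact integral_congr_ae (by filter_upwards [hP] with x hx using hx.symm)
  have hE' : relEnergy γ f u' w' =
      1 / 2 * (∑ i, ‖u'.grad i - w'.grad i‖ ^ 2) + 1 / γ * ∫ x in Ω, P' x := by
    rw [relEnergy, integral_const_mul]
    congr 2
    exact integral_congr_ae (by filter_upwards [hP'] with x hx using hx.symm)
  -- The increment of `φ - φh` is itself an `H¹` function, hence admissible in the potential
  -- equations at both times. Their sum removes the gradients and leaves a trapezoidal term in `f'`,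
  -- which cancels the one from the potential.
  set ξ : H1 Ω := (u' - w') - (u - w) with hξ
  have hξL : ξ.toL2 = du := rfl
  have hξg : ∀ i, ξ.grad i = (u'.grad i - w'.grad i) - (u.grad i - w.grad i) := fun i => rfl
  have hgrad : 1 / 2 * (∑ i, ‖u'.grad i - w'.grad i‖ ^ 2) -
      1 / 2 * (∑ i, ‖u.grad i - w.grad i‖ ^ 2) =
      1 / 2 * (inner ℝ du (G' + G) - 1 / γ * inner ℝ du (D' + D)) := by
    have h1 := hG ξ
    have h2 := hG' ξ
    rw [hξL] at h1 h2
    have h3 : (∑ i, ‖u'.grad i - w'.grad i‖ ^ 2) - (∑ i, ‖u.grad i - w.grad i‖ ^ 2) =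
        (∑ i, inner ℝ (u'.grad i - w'.grad i) (ξ.grad i)) +
          ∑ i, inner ℝ (u.grad i - w.grad i) (ξ.grad i) := by
      rw [← Finset.sum_sub_distrib, ← Finset.sum_add_distrib]
      refine Finset.sum_congr rfl fun i _ => ?_
      rw [hξg]
      exact norm_sq_sub_norm_sq _ _
    rw [inner_add_right, inner_add_right, real_inner_comm G', real_inner_comm G, real_inner_comm D',
      real_inner_comm D]
    linear_combination (1 / 2) * h3 - (1 / 2) * h1 - (1 / 2) * h2
  have hpot : |(∫ x in Ω, P' x) - (∫ x in Ω, P x) - 1 / 2 * inner ℝ du (D' + D)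
      - 1 / 2 * inner ℝ dw (R' + R)| ≤ 3 * (3 * L + 2 * M * L) * (‖du‖ ^ 2 + ‖dw‖ ^ 2) := by
    have i1 : Integrable (fun x => P' x - P x) (volume.restrict Ω) := hPi'.sub hPi
    have i2 : Integrable (fun x => 1 / 2 * (du x * (D' + D : L2 Ω) x)) (volume.restrict Ω) :=
      (integrable_mul_L2 du (D' + D)).const_mul _
    have i3 : Integrable (fun x => 1 / 2 * (dw x * (R' + R : L2 Ω) x)) (volume.restrict Ω) :=
      (integrable_mul_L2 dw (R' + R)).const_mul _
    have i4 : Integrable (fun x => P' x - P x - 1 / 2 * (du x * (D' + D : L2 Ω) x))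
      (volume.restrict Ω) := i1.sub i2
    rw [inner_eq_integral_mul, inner_eq_integral_mul, norm_sq_eq_integral, norm_sq_eq_integral,
      ← integral_sub hPi' hPi, ← integral_const_mul, ← integral_const_mul,
      ← integral_sub i1 i2, ← integral_sub i4 i3,
      ← integral_add (integrable_sq_L2 du) (integrable_sq_L2 dw), ← integral_const_mul,
      ← Real.norm_eq_abs]
    refine norm_integral_le_of_norm_le
      (((integrable_sq_L2 du).add (integrable_sq_L2 dw)).const_mul _) ?_
    filter_upwards [hu, hw, hu', hw', hD, hD', hR, hR', hP, hP', hdue, hdwe,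
      Lp.coeFn_add D' D, Lp.coeFn_add R' R]
      with x e1 e2 e3 e4 e5 e6 e7 e8 e9 e10 e11 e12 e13 e14
    rw [e13, e14, Pi.add_apply, Pi.add_apply, e5, e6, e7, e8, e9, e10, e11, e12]
    exact abs_relPotential_trapezoid_le h h' e1 e2 e3 e4
  have heq : relEnergy γ f u' w' - relEnergy γ f u w
      - 1 / 2 * (inner ℝ du (G' + G) + inner ℝ dw ((1 / γ) • R' + (1 / γ) • R)) =
      1 / γ * ((∫ x in Ω, P' x) - (∫ x in Ω, P x) - 1 / 2 * inner ℝ du (D' + D)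
      - 1 / 2 * inner ℝ dw (R' + R)) := by
    rw [hE, hE', ← smul_add, real_inner_smul_right]
    linear_combination hgrad
  have hγ' : 0 ≤ 1 / γ := by positivity
  rw [heq, abs_mul, abs_of_nonneg hγ', mul_assoc]
  exact mul_le_mul_of_nonneg_left hpot hγ'

/-! ### The dissipation rate at a fixed time -/

theorem integrable_comp_mul {α : Type*} [MeasurableSpace α] {ν : Measure α} {g : ℝ → ℝ}
    (hg : Continuous g) {u : α → ℝ} (hu : AEStronglyMeasurable u ν) {B : ℝ}
    (hB : ∀ᵐ x ∂ν, |g (u x)| ≤ B) {k : α → ℝ} (hk : Integrable k ν) :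
    Integrable (fun x => g (u x) * k x) ν :=
  hk.bdd_mul (hg.comp_aestronglyMeasurable hu) hB

theorem MobilityAssumption.abs_le {b : ℝ → ℝ} {b₁ b₂ b₃ b₄ : ℝ}
    (hb : MobilityAssumption b b₁ b₂ b₃ b₄) (s : ℝ) : |b s| ≤ b₂ := by
  rw [abs_of_pos (hb.pos.trans_le (hb.lower s))]
  exact hb.upper s

theorem MobilityAssumption.abs_sub_le {b : ℝ → ℝ} {b₁ b₂ b₃ b₄ : ℝ}
    (hb : MobilityAssumption b b₁ b₂ b₃ b₄) (s t : ℝ) : |b s - b t| ≤ b₃ * |s - t| :=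
  convex_univ.norm_image_sub_le_of_norm_deriv_le
    (fun x _ => hb.contDiff.differentiable (by simp) x) (fun x _ => hb.deriv_le x) (mem_univ t)
    (mem_univ s)

theorem abs_relPotential_deriv_le {f : ℝ → ℝ} {f₁ : ℝ} {f₂ f₃ : ℕ → ℝ}
    (hf : PotentialAssumption f f₁ f₂ f₃) {a c S : ℝ} (ha : a ∈ Icc (-1 : ℝ) 1) (hc : |c| ≤ S) :
    |relPotential (deriv f) a c| ≤ (f₂ 3 + f₃ 3 * (1 + S)) * (a - c) ^ 2 := by
  have hS : 0 ≤ S := (abs_nonneg c).trans hc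
  have hd : ContDiff ℝ 2 (deriv f) := by
    have h3 : ContDiff ℝ (2 + 1) f := hf.contDiff.of_le (by norm_num)
    exact (contDiff_succ_iff_deriv.1 h3).2.2
  -- The interval `[-(1 + S), 1 + S]` contains both `a` and `c`, and on it the growth condition with
  -- `k = 3`, which is linear in `|s|`, gives the constant `C₁`.
  refine abs_relPotential_le hd (r := 1 + S) (fun s hs => ?_)
    ⟨by linarith [ha.1], by linarith [ha.2]⟩ (by
      rw [abs_le] at hc
      exact ⟨by linarith [hc.1], by linarith [hc.2]⟩)
  have h := hf.growth 3 (by norm_num) s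
  rw [iteratedDeriv_succ, iteratedDeriv_succ, iteratedDeriv_one] at h
  refine h.trans ?_
  have h3 := hf.f₃_nonneg 3 (by norm_num)
  norm_num
  gcongr
  exact abs_le.2 hs

/-- The estimate of the dissipation rate at a fixed time. -/
theorem rate_le {Ω : Set (Space d)} [IsFiniteMeasure (volume.restrict Ω)] {γ : ℝ} (hγ : 0 < γ)
    {b : ℝ → ℝ} {b₁ b₂ b₃ b₄ : ℝ} (hb : MobilityAssumption b b₁ b₂ b₃ b₄)
    {f : ℝ → ℝ} {f₁ : ℝ} {f₂ f₃ : ℕ → ℝ} (hf : PotentialAssumption f f₁ f₂ f₃)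
    {a c at' ct m r₁ r₂ G R : L2 Ω} {n : LInf Ω}
    (ha : ∀ᵐ x ∂(volume.restrict Ω), a x ∈ Icc (-1 : ℝ) 1)
    (hc : MemLp c ∞ (volume.restrict Ω)) (hct : MemLp ct ∞ (volume.restrict Ω))
    (hG : G = m - inclL2 n + r₂)
    (hR : R =ᵐ[volume.restrict Ω] fun x => relPotential (deriv f) (a x) (c x))
    (h1 : ∀ ψ : L2 Ω, (∫ x in Ω, at' x * ψ x) + ∫ x in Ω, b (a x) * m x * ψ x = 0)
    (h2 : ∀ ψ : L2 Ω, (∫ x in Ω, ct x * ψ x) + ∫ x in Ω, b (c x) * n x * ψ x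
      = ∫ x in Ω, r₁ x * ψ x)
    {C₁ C₂ C₃ C₄ : ℝ} (hC₁ : C₁ = f₂ 3 + f₃ 3 * (1 + supNorm c))
    (hC₂ : C₂ = 1 / 2 + 3 / b₁) (hC₃ : C₃ = 1 + 3 * b₂)
    (hC₄ : C₄ = b₃ ^ 2 + 6 * b₃ ^ 2 / b₁ ∨ (b₁ ≤ 10 ∧ C₄ = b₃ + 6 * b₃ ^ 2 / b₁ ^ 2)) :
    (inner ℝ (at' - ct) G + inner ℝ ct ((1 / γ) • R)) + 1 / 2 * relDissipation b a m n ≤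
      (C₁ / γ * supNorm ct + C₄ * ‖n‖ ^ 2) * ‖a - c‖ ^ 2 + C₂ * ‖r₁‖ ^ 2 + C₃ * ‖r₂‖ ^ 2 := by
  have hbc : Continuous b := hb.contDiff.continuous
  have hb₃ : 0 ≤ b₃ := (abs_nonneg _).trans (hb.deriv_le 0)
  set k : L2 Ω := m - inclL2 n with hk
  have hke : k =ᵐ[volume.restrict Ω] fun x => m x - n x := by
    filter_upwards [Lp.coeFn_sub m (inclL2 n), coeFn_inclL2 n] with x e1 e2
    rw [e1, Pi.sub_apply, e2]
  have hGe : G =ᵐ[volume.restrict Ω] fun x => m x - n x + r₂ x := by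
    filter_upwards [Lp.coeFn_add k r₂, hke] with x e1 e2
    rw [hG, e1, Pi.add_apply, e2]
  have hace : (a - c : L2 Ω) =ᵐ[volume.restrict Ω] fun x => a x - c x := Lp.coeFn_sub _ _
  have hD : relDissipation b a m n = ∫ x in Ω, b (a x) * k x ^ 2 := by
    refine integral_congr_ae ?_
    filter_upwards [hke] with x e
    rw [mul_pow, Real.sq_sqrt (hb.pos.le.trans (hb.lower _)), e]
  have hn2 : ∫ x in Ω, b (c x) * n x * G x = ∫ x in Ω, b (c x) * (inclL2 n x * G x) := by
    refine integral_congr_ae ?_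
    filter_upwards [coeFn_inclL2 n] with x e
    rw [e, mul_assoc]
  -- Both evolution equations are tested with `G`; their difference replaces the time derivatives in
  -- the rate.
  have h1' := h1 G
  have h2' := h2 G
  rw [hn2] at h2'
  simp only [mul_assoc] at h1'
  have i1 : Integrable (fun x => b (a x) * (m x * G x)) (volume.restrict Ω) :=
    integrable_comp_mul hbc (Lp.aestronglyMeasurable a) (ae_of_all _ fun x => hb.abs_le _)
      (integrable_mul_L2 m G)
  have i2 : Integrable (fun x => b (c x) * (inclL2 n x * G x)) (volume.restrict Ω) :=
    integrable_comp_mul hbc (Lp.aestronglyMeasurable c) (ae_of_all _ fun x => hb.abs_le _)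
      (integrable_mul_L2 (inclL2 n) G)
  have i3 := integrable_mul_L2 r₁ G
  have i4 : Integrable (fun x => 1 / γ * (ct x * R x)) (volume.restrict Ω) :=
    (integrable_mul_L2 ct R).const_mul _
  have i5 : Integrable (fun x => 1 / 2 * (b (a x) * k x ^ 2)) (volume.restrict Ω) :=
    (integrable_comp_mul hbc (Lp.aestronglyMeasurable a) (ae_of_all _ fun x => hb.abs_le _)
      (integrable_sq_L2 k)).const_mul _
  have i12 : Integrable (fun x => b (c x) * (inclL2 n x * G x) - b (a x) * (m x * G x))
      (volume.restrict Ω) := i2.sub i1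
  have i123 : Integrable (fun x => b (c x) * (inclL2 n x * G x) - b (a x) * (m x * G x)
      - r₁ x * G x) (volume.restrict Ω) := i12.sub i3
  have i1234 : Integrable (fun x => b (c x) * (inclL2 n x * G x) - b (a x) * (m x * G x)
      - r₁ x * G x + 1 / γ * (ct x * R x)) (volume.restrict Ω) := i123.add i4
  have hL : (inner ℝ (at' - ct) G + inner ℝ ct ((1 / γ) • R)) + 1 / 2 * relDissipation b a m n =
      ∫ x in Ω, (b (c x) * (inclL2 n x * G x) - b (a x) * (m x * G x) - r₁ x * G x
        + 1 / γ * (ct x * R x) + 1 / 2 * (b (a x) * k x ^ 2)) := by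
    rw [integral_add i1234 i5, integral_add i123 i4, integral_sub i12 i3, integral_sub i2 i1,
      integral_const_mul, integral_const_mul, hD, inner_sub_left, real_inner_smul_right,
      inner_eq_integral_mul, inner_eq_integral_mul, inner_eq_integral_mul]
    linear_combination h1' - h2'
  have j1 : Integrable (fun x => (C₁ / γ * supNorm ct + C₄ * ‖n‖ ^ 2) * (a - c : L2 Ω) x ^ 2)
      (volume.restrict Ω) := (integrable_sq_L2 (a - c)).const_mul _
  have j2 : Integrable (fun x => C₂ * r₁ x ^ 2) (volume.restrict Ω) :=
    (integrable_sq_L2 r₁).const_mul _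
  have j3 : Integrable (fun x => C₃ * r₂ x ^ 2) (volume.restrict Ω) :=
    (integrable_sq_L2 r₂).const_mul _
  have j12 : Integrable (fun x => (C₁ / γ * supNorm ct + C₄ * ‖n‖ ^ 2) * (a - c : L2 Ω) x ^ 2
      + C₂ * r₁ x ^ 2) (volume.restrict Ω) := j1.add j2
  rw [hL, norm_sq_eq_integral, norm_sq_eq_integral, norm_sq_eq_integral, ← integral_const_mul,
    ← integral_const_mul, ← integral_const_mul, ← integral_add j1 j2, ← integral_add j12 j3]
  refine integral_mono_ae (i1234.add i5) (j12.add j3) ?_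
  filter_upwards [ha, ae_abs_le_supNorm hc, ae_abs_le_supNorm hct, ae_abs_le_norm n, hke, hGe, hace,
    hR, coeFn_inclL2 n] with x e1 e2 e3 e4 e5 e6 e7 e8 e9
  rw [e5, e6, e7, e8, e9]
  have hp : ((b (a x) - b (c x)) * n x) ^ 2 ≤ b₃ ^ 2 * (‖n‖ ^ 2 * (a x - c x) ^ 2) := by
    have h3 : |(b (a x) - b (c x)) * n x| ≤ b₃ * |a x - c x| * ‖n‖ := by
      rw [abs_mul]
      exact mul_le_mul (hb.abs_sub_le _ _) e4 (abs_nonneg _) (by positivity)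
    calc ((b (a x) - b (c x)) * n x) ^ 2 = |(b (a x) - b (c x)) * n x| ^ 2 := (sq_abs _).symm
      _ ≤ (b₃ * |a x - c x| * ‖n‖) ^ 2 := by gcongr
      _ = _ := by rw [mul_pow, mul_pow, sq_abs]; ring
  have hdis := dissipation_estimate (m := m x - n x) (q₁ := r₁ x) (q₂ := r₂ x) hb.pos
    (hb.lower (a x)) (hb.upper (a x)) hb₃ hp hC₂ hC₃ hC₄
  have hpot : 1 / γ * (ct x * relPotential (deriv f) (a x) (c x)) ≤
      C₁ / γ * supNorm ct * (a x - c x) ^ 2 := by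
    have h4 := abs_relPotential_deriv_le hf e1 e2
    rw [← hC₁] at h4
    have h5 : ct x * relPotential (deriv f) (a x) (c x) ≤ supNorm ct * (C₁ * (a x - c x) ^ 2) := by
      refine (le_abs_self _).trans ?_
      rw [abs_mul]
      exact mul_le_mul e3 h4 (abs_nonneg _) ((abs_nonneg _).trans e3)
    calc _ ≤ 1 / γ * (supNorm ct * (C₁ * (a x - c x) ^ 2)) := by gcongr
      _ = _ := by ring
  linear_combination hdis + hpot

/-- Testing the equation with `ψ = μh` uses the lower bound on `b`. Continuity of `μh` on the open
time interval alone allows growth at its ends; this estimate gives square integrability in time. -/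
theorem norm_inclL2_le {Ω : Set (Space d)} [IsFiniteMeasure (volume.restrict Ω)]
    {b : ℝ → ℝ} {b₁ b₂ b₃ b₄ : ℝ} (hb : MobilityAssumption b b₁ b₂ b₃ b₄)
    {c ct r₁ : L2 Ω} {n : LInf Ω}
    (h2 : ∀ ψ : L2 Ω, (∫ x in Ω, ct x * ψ x) + ∫ x in Ω, b (c x) * n x * ψ x
      = ∫ x in Ω, r₁ x * ψ x) : ‖inclL2 n‖ ≤ b₁⁻¹ * ‖r₁ - ct‖ := by
  have h := h2 (inclL2 n)
  have hn2 : ∫ x in Ω, b (c x) * n x * inclL2 n x = ∫ x in Ω, b (c x) * inclL2 n x ^ 2 := by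
    refine integral_congr_ae ?_
    filter_upwards [coeFn_inclL2 n] with x e
    rw [e]; ring
  have hle : b₁ * ‖inclL2 n‖ ^ 2 ≤ ∫ x in Ω, b (c x) * inclL2 n x ^ 2 := by
    rw [norm_sq_eq_integral, ← integral_const_mul]
    refine integral_mono ((integrable_sq_L2 _).const_mul _)
      (integrable_comp_mul hb.contDiff.continuous (Lp.aestronglyMeasurable c)
        (ae_of_all _ fun x => hb.abs_le _) (integrable_sq_L2 (inclL2 n))) fun x => ?_
    exact mul_le_mul_of_nonneg_right (hb.lower _) (sq_nonneg _)
  have hin : inner ℝ (r₁ - ct) (inclL2 n) = ∫ x in Ω, b (c x) * inclL2 n x ^ 2 := by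
    rw [inner_sub_left, inner_eq_integral_mul, inner_eq_integral_mul, ← hn2]
    linarith
  have hcs := real_inner_le_norm (r₁ - ct) (inclL2 n)
  rw [hin] at hcs
  rcases (norm_nonneg (inclL2 n)).eq_or_lt with h0 | h0
  · rw [← h0]
    have := hb.pos
    positivity
  · rw [le_inv_mul_iff₀ hb.pos]
    refine le_of_mul_le_mul_right ?_ h0
    linarith

/-! ### The chain rule along the two solutions -/

instance (T : ℝ) : IsFiniteMeasure (timeMeasure T) := by
  unfold timeMeasure; infer_instance

theorem ae_norm_le_of_memLp_top {α X : Type*} [MeasurableSpace α] [NormedAddCommGroup X]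
    {ν : Measure α} {u : α → X} (hu : MemLp u ∞ ν) : ∃ B, 0 ≤ B ∧ ∀ᵐ t ∂ν, ‖u t‖ ≤ B := by
  refine ⟨(eLpNormEssSup u ν).toReal, ENNReal.toReal_nonneg, ?_⟩
  filter_upwards [ae_le_eLpNormEssSup (f := u) (μ := ν)] with t ht
  rw [← toReal_enorm]
  refine ENNReal.toReal_mono ?_ ht
  have := hu.eLpNorm_ne_top
  rwa [eLpNorm_exponent_top] at this

theorem integrable_inner_of_memLp {α X : Type*} [MeasurableSpace α] [NormedAddCommGroup X]
    [InnerProductSpace ℝ X] {ν : Measure α} {u v : α → X} (hu : MemLp u 2 ν) (hv : MemLp v 2 ν) :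
    Integrable (fun t => (inner ℝ (u t) (v t) : ℝ)) ν := by
  refine (L2.integrable_inner (𝕜 := ℝ) hu.toLp hv.toLp).congr ?_
  filter_upwards [hu.coeFn_toLp, hv.coeFn_toLp] with t h1 h2
  rw [h1, h2]

theorem memLp_toL2 {Ω : Set (Space d)} {p : ℝ≥0∞} {τ : Measure ℝ} {u : ℝ → H1 Ω}
    (hu : MemLp u p τ) : MemLp (fun t => (u t).toL2) p τ :=
  hu.of_le (continuous_toL2.comp_aestronglyMeasurable hu.1) (ae_of_all _ fun _ => norm_toL2_le _)

theorem memLp_toH1 {Ω : Set (Space d)} {p : ℝ≥0∞} {τ : Measure ℝ} {u : ℝ → H2 Ω}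
    (hu : MemLp u p τ) : MemLp (fun t => (u t).toH1) p τ :=
  hu.of_le (continuous_toH1.comp_aestronglyMeasurable hu.1) (ae_of_all _ fun _ => norm_toH1_le _)

theorem memLp_grad {Ω : Set (Space d)} {p : ℝ≥0∞} {τ : Measure ℝ} {u : ℝ → H1 Ω}
    (hu : MemLp u p τ) (i : Fin d) : MemLp (fun t => (u t).grad i) p τ :=
  hu.of_le ((continuous_grad i).comp_aestronglyMeasurable hu.1)
    (ae_of_all _ fun _ => norm_grad_le _ i)

/-- The chemical potential equation for the difference of a solution and a perturbed solution. -/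
theorem inner_sub_eq_zero {Ω : Set (Space d)} [IsFiniteMeasure (volume.restrict Ω)] {γ M : ℝ}
    {f : ℝ → ℝ} {L : ℝ} (hL : BoxBound f M L) (hfc : Continuous (deriv f)) {u w : H1 Ω}
    {m r D : L2 Ω} {n : LInf Ω}
    (hu : ∀ᵐ x ∂(volume.restrict Ω), u.toL2 x ∈ Icc (-M) M)
    (hw : ∀ᵐ x ∂(volume.restrict Ω), w.toL2 x ∈ Icc (-M) M)
    (hD : D =ᵐ[volume.restrict Ω] fun x => deriv f (u.toL2 x) - deriv f (w.toL2 x))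
    (h1 : ∀ ξ : H1 Ω, (∫ x in Ω, m x * ξ.toL2 x) - (∑ i, ∫ x in Ω, u.grad i x * ξ.grad i x)
      - 1 / γ * ∫ x in Ω, deriv f (u.toL2 x) * ξ.toL2 x = 0)
    (h2 : ∀ ξ : H1 Ω, (∫ x in Ω, n x * ξ.toL2 x) - (∑ i, ∫ x in Ω, w.grad i x * ξ.grad i x)
      - 1 / γ * ∫ x in Ω, deriv f (w.toL2 x) * ξ.toL2 x = ∫ x in Ω, r x * ξ.toL2 x) (ξ : H1 Ω) :
    inner ℝ (m - inclL2 n + r) ξ.toL2 - ∑ i, inner ℝ (u.grad i - w.grad i) (ξ.grad i)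
      - 1 / γ * inner ℝ D ξ.toL2 = 0 := by
  have hξ : Integrable ξ.toL2 (volume.restrict Ω) := (Lp.memLp ξ.toL2).integrable one_le_two
  have i1 : Integrable (fun x => deriv f (u.toL2 x) * ξ.toL2 x) (volume.restrict Ω) :=
    integrable_comp_mul hfc (Lp.aestronglyMeasurable _)
      (by filter_upwards [hu] with x hx using hL.deriv_le _ hx) hξ
  have i2 : Integrable (fun x => deriv f (w.toL2 x) * ξ.toL2 x) (volume.restrict Ω) :=
    integrable_comp_mul hfc (Lp.aestronglyMeasurable _)
      (by filter_upwards [hw] with x hx using hL.deriv_le _ hx) hξ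
  have e1 : inner ℝ D ξ.toL2 = (∫ x in Ω, deriv f (u.toL2 x) * ξ.toL2 x)
      - ∫ x in Ω, deriv f (w.toL2 x) * ξ.toL2 x := by
    rw [inner_eq_integral_mul, ← integral_sub i1 i2]
    refine integral_congr_ae ?_
    filter_upwards [hD] with x hx
    rw [hx, sub_mul]
  have e2 : inner ℝ (inclL2 n) ξ.toL2 = ∫ x in Ω, n x * ξ.toL2 x := by
    rw [inner_eq_integral_mul]
    refine integral_congr_ae ?_
    filter_upwards [coeFn_inclL2 n] with x hx
    rw [hx]
  have h1' := h1 ξ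
  have h2' := h2 ξ
  simp only [← inner_eq_integral_mul] at h1' h2' e1 e2
  simp only [inner_add_left, inner_sub_left, Finset.sum_sub_distrib, e1, e2]
  linear_combination h1' - h2'

/-- The data of the chain rule for the relative energy along a solution and a perturbed solution. -/
theorem exists_relEnergy_increment {Ω : Set (Space d)} (hd : d ≤ 3) (hΩ : IsRegularDomain Ω)
    [IsFiniteMeasure (volume.restrict Ω)]
    {T γ : ℝ} (hγ : 0 < γ) {b : ℝ → ℝ} {b₁ b₂ b₃ b₄ : ℝ} (hb : MobilityAssumption b b₁ b₂ b₃ b₄)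
    {f : ℝ → ℝ} (hf : ContDiff ℝ 4 f) {φ : ℝ → H1 Ω} {φt μ : ℝ → L2 Ω}
    (hφ : IsWeakSolution Ω T γ b f φ φt μ) {φh φht : ℝ → H2 Ω} {μh : ℝ → LInf Ω}
    {r₁ r₂ : ℝ → L2 Ω} (hφh : IsPerturbedSolution Ω T γ b f φh φht μh r₁ r₂) :
    ∃ R : ℝ → L2 Ω, (∀ᵐ t ∂(timeMeasure T), R t =ᵐ[volume.restrict Ω] fun x =>
        relPotential (deriv f) ((φ t).toL2 x) ((φh t).toL2 x)) ∧
      IntegrableOn (fun t => inner ℝ (φt t - (φht t).toL2) (μ t - inclL2 (μh t) + r₂ t)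
        + inner ℝ (φht t).toL2 ((1 / γ) • R t)) (Ioo 0 T) ∧
      ∃ S ⊆ Ioo 0 T, (∀ᵐ t ∂(volume.restrict (Ioo 0 T)), t ∈ S) ∧ ∀ s ∈ S, ∀ t ∈ S,
        relEnergy γ f (φ t) (φh t).toH1 - relEnergy γ f (φ s) (φh s).toH1 =
          ∫ x in s..t, (inner ℝ (φt x - (φht x).toL2) (μ x - inclL2 (μh x) + r₂ x)
            + inner ℝ (φht x).toL2 ((1 / γ) • R x)) := by
  have hf1 : ContDiff ℝ 2 f := hf.of_le (by norm_num)
  have hf2 : ContDiff ℝ 2 (deriv f) := by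
    have h3 : ContDiff ℝ (2 + 1) f := hf.of_le (by norm_num)
    exact (contDiff_succ_iff_deriv.1 h3).2.2
  obtain ⟨Cs, hCs, hsob⟩ := exists_sobolev_bound hd hΩ
  obtain ⟨B, hB0, hB⟩ := ae_norm_le_of_memLp_top hφh.mem_phi.memLp
  -- One box for both functions: `1` bounds `φ`, and the Sobolev bound `Cs * B` controls `φh` at
  -- almost every time.
  obtain ⟨M, hM1, hMB⟩ : ∃ M : ℝ, 1 ≤ M ∧ Cs * B ≤ M := ⟨max 1 (Cs * B), le_max_left _ _,
    le_max_right _ _⟩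
  have hM0 : 0 ≤ M := zero_le_one.trans hM1
  have hbox : ∀ᵐ t ∂(timeMeasure T), ∀ᵐ x ∂(volume.restrict Ω), (φ t).toL2 x ∈ Icc (-M) M := by
    filter_upwards [hφ.range] with t ht
    filter_upwards [ht] with x hx using ⟨by linarith [hx.1], hx.2.trans hM1⟩
  have hboxh : ∀ᵐ t ∂(timeMeasure T), ∀ᵐ x ∂(volume.restrict Ω),
      (φh t).toL2 x ∈ Icc (-M) M := by
    filter_upwards [hB] with t ht
    filter_upwards [hsob (φh t)] with x hx
    exact abs_le.1 (hx.trans ((mul_le_mul_of_nonneg_left ht hCs).trans hMB))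
  obtain ⟨L1, hL1⟩ := exists_boxBound hf1 M
  obtain ⟨L2', hL2⟩ := exists_boxBound hf2 M
  obtain ⟨L, hL, hL'⟩ : ∃ L, BoxBound f M L ∧ BoxBound (deriv f) M L :=
    ⟨max L1 L2', hL1.mono (le_max_left _ _), hL2.mono (le_max_right _ _)⟩
  have hL0 := hL.nonneg
  have hφm : MemLp (fun t => (φ t).toL2) 2 (timeMeasure T) :=
    (memLp_toL2 hφ.mem_phi.memLp_H1).mono_exponent le_top
  have hφhm : MemLp (fun t => (φh t).toL2) 2 (timeMeasure T) :=
    (memLp_toL2 (memLp_toH1 hφh.mem_phi.memLp)).mono_exponent le_top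
  have hφhtm : MemLp (fun t => (φht t).toL2) 2 (timeMeasure T) :=
    (memLp_toL2 (memLp_toH1 hφh.mem_phi.memLp_deriv)).mono_exponent le_top
  obtain ⟨D, hDm, -, hD⟩ := exists_superposition (ν := volume.restrict Ω) hM0 (K := L)
    hL0 (Φ := fun a c => deriv f a - deriv f c) (fun a ha c hc a' ha' c' hc' => by
      have e : deriv f a' - deriv f c' - (deriv f a - deriv f c) =
        (deriv f a' - deriv f a) - (deriv f c' - deriv f c) := by ring
      rw [e, mul_add]
      exact (abs_sub _ _).trans (add_le_add (hL.lip_deriv _ ha' _ ha) (hL.lip_deriv _ hc' _ hc)))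
    hφm.1 hφhm.1
  obtain ⟨R, hRm, ⟨BR, hBR⟩, hR⟩ := exists_superposition (ν := volume.restrict Ω) hM0
    (K := 2 * L + 2 * M * L) (by positivity) (Φ := relPotential (deriv f))
    (fun a ha c hc a' ha' c' hc' => hL'.abs_relPotential_sub_le ha hc ha' hc') hφm.1 hφhm.1
  obtain ⟨P, hPm, ⟨BP, hBP⟩, hP⟩ := exists_superposition (ν := volume.restrict Ω) hM0
    (K := 2 * L + 2 * M * L) (by positivity) (Φ := relPotential f)
    (fun a ha c hc a' ha' c' hc' => hL.abs_relPotential_sub_le ha hc ha' hc') hφm.1 hφhm.1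
  have hRL₀ : MemLp R 2 (timeMeasure T) := MemLp.of_bound hRm BR (ae_of_all _ hBR)
  have hRL : MemLp (fun t => (1 / γ) • R t) 2 (timeMeasure T) := hRL₀.const_smul (1 / γ)
  have hPL : MemLp P 2 (timeMeasure T) := MemLp.of_bound hPm BP (ae_of_all _ hBP)
  have hμhm : MemLp (fun t => inclL2 (μh t)) 2 (timeMeasure T) := by
    refine MemLp.of_le_mul (g := fun t => r₁ t - (φht t).toL2) (c := b₁⁻¹)
      (hφh.mem_r₁.sub hφhtm) ?_ ?_
    · exact continuous_inclL2.comp_aestronglyMeasurable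
        (hφh.mem_mu.aestronglyMeasurable measurableSet_Ioo)
    · filter_upwards [hφh.eq_phi] with t ht using norm_inclL2_le hb ht
  have hGm : MemLp (fun t => μ t - inclL2 (μh t) + r₂ t) 2 (timeMeasure T) :=
    (hφ.mem_mu.sub hμhm).add hφh.mem_r₂
  have hVm : MemLp (fun t => φt t - (φht t).toL2) 2 (timeMeasure T) :=
    hφ.mem_phi.memLp_deriv.sub hφhtm
  obtain ⟨S₁, hS₁T, hS₁, hinc₁⟩ := exists_increment_eq_integral (T := T)
    (hφm.integrable one_le_two) (hφ.mem_phi.memLp_deriv.integrable one_le_two)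
    hφ.mem_phi.hasDeriv
  obtain ⟨S₂, hS₂T, hS₂, hinc₂⟩ := exists_increment_eq_integral (T := T)
    (hφhm.integrable one_le_two) (hφhtm.integrable one_le_two) hφh.mem_phi.hasDeriv
  set Good : Set ℝ := {t | (∀ᵐ x ∂(volume.restrict Ω), (φ t).toL2 x ∈ Icc (-M) M) ∧
    (∀ᵐ x ∂(volume.restrict Ω), (φh t).toL2 x ∈ Icc (-M) M) ∧
    ∀ ξ : H1 Ω, inner ℝ (μ t - inclL2 (μh t) + r₂ t) ξ.toL2
      - ∑ i, inner ℝ ((φ t).grad i - (φh t).toH1.grad i) (ξ.grad i)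
      - 1 / γ * inner ℝ (D t) ξ.toL2 = 0} with hGood
  have hGoodae : ∀ᵐ t ∂(timeMeasure T), t ∈ Good := by
    filter_upwards [hbox, hboxh, hφ.eq_mu, hφh.eq_mu] with t h1 h2 h3 h4
    exact ⟨h1, h2, inner_sub_eq_zero hL (hf2.continuous) h1 h2 (hD t h1 h2) h3 h4⟩
  have hEi : IntegrableOn (fun t => relEnergy γ f (φ t) (φh t).toH1) (Ioo 0 T) := by
    -- Pairing with the constant function `1` expresses the integral of the potential through the
    -- curve `P` in `L²`, whose measurability is known.
    have hone : MemLp (fun _ : Space d => (1 : ℝ)) 2 (volume.restrict Ω) := memLp_const 1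
    have hgr : ∀ i, Integrable (fun t => ‖(φ t).grad i - (φh t).toH1.grad i‖ ^ 2)
        (timeMeasure T) := fun i => by
      have h := ((memLp_grad hφ.mem_phi.memLp_H1 i).sub
        (memLp_grad (memLp_toH1 hφh.mem_phi.memLp) i)).mono_exponent (p := 2) le_top
      exact (memLp_two_iff_integrable_sq_norm h.1).1 h
    have hI : Integrable (fun t => 1 / 2 * (∑ i, ‖(φ t).grad i - (φh t).toH1.grad i‖ ^ 2)
        + 1 / γ * inner ℝ (P t) hone.toLp) (timeMeasure T) :=
      ((integrable_finsetSum _ fun i _ => hgr i).const_mul _).add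
        (((hPL.integrable one_le_two).inner_const _).const_mul _)
    refine hI.congr ?_
    filter_upwards [hbox, hboxh] with t h1 h2
    rw [relEnergy, integral_const_mul, inner_eq_integral_mul]
    congr 2
    refine integral_congr_ae ?_
    filter_upwards [hone.coeFn_toLp, hP t h1 h2] with x e1 e2
    rw [e1, e2, mul_one]
    rfl
  refine ⟨R, ?_, ?_, ?_⟩
  · filter_upwards [hbox, hboxh] with t h1 h2 using hR t h1 h2
  · exact (integrable_inner_of_memLp hVm hGm).add (integrable_inner_of_memLp hφhtm hRL)
  -- Two components: `φ - φh` is paired with `G`, and `φh` with `R / γ`.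
  obtain ⟨S, hS, hSae, hSinc⟩ := exists_increment_eq_integral_of_estimate (ι := Fin 2)
    (X := L2 Ω) (T := T) (E := fun t => relEnergy γ f (φ t) (φh t).toH1)
    (U := ![fun t => (φ t).toL2 - (φh t).toL2, fun t => (φh t).toL2])
    (V := ![fun t => φt t - (φht t).toL2, fun t => (φht t).toL2])
    (G := ![fun t => μ t - inclL2 (μh t) + r₂ t, fun t => (1 / γ) • R t])
    (S := S₁ ∩ S₂ ∩ Good) (C := 1 / γ * (3 * (3 * L + 2 * M * L)))
    hEi (Fin.forall_fin_two.2 ⟨hφm.sub hφhm, hφhm⟩) (Fin.forall_fin_two.2 ⟨hVm, hφhtm⟩)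
    (Fin.forall_fin_two.2 ⟨hGm, hRL⟩) (fun t ht => hS₁T ht.1.1)
    (by filter_upwards [hS₁, hS₂, hGoodae] with t h1 h2 h3 using ⟨⟨h1, h2⟩, h3⟩)
    (Fin.forall_fin_two.2 ⟨fun s hs t ht => by
      have hsub : uIoc s t ⊆ Ioo 0 T := by
        have h1 := hS₁T hs.1.1
        have h2 := hS₁T ht.1.1
        intro x hx
        exact ⟨(lt_min h1.1 h2.1).trans hx.1, hx.2.trans_lt (max_lt h1.2 h2.2)⟩
      have i1 : IntervalIntegrable φt volume s t := intervalIntegrable_iff.2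
        (IntegrableOn.mono_set (hφ.mem_phi.memLp_deriv.integrable one_le_two) hsub)
      have i2 : IntervalIntegrable (fun t => (φht t).toL2) volume s t := intervalIntegrable_iff.2
        (IntegrableOn.mono_set (hφhtm.integrable one_le_two) hsub)
      have := intervalIntegral.integral_sub i1 i2
      simp only [Matrix.cons_val_zero]
      rw [this, ← hinc₁ s hs.1.1 t ht.1.1, ← hinc₂ s hs.1.2 t ht.1.2]
      abel, fun s hs t ht => hinc₂ s hs.1.2 t ht.1.2⟩)
    (fun s hs t ht => by
      simp only [Fin.sum_univ_two, Matrix.cons_val_zero, Matrix.cons_val_one]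
      exact abs_relEnergy_increment_le hγ hL hL' hs.2.1 hs.2.2.1 ht.2.1 ht.2.2.1
        (hD s hs.2.1 hs.2.2.1) (hD t ht.2.1 ht.2.2.1) (hR s hs.2.1 hs.2.2.1)
        (hR t ht.2.1 ht.2.2.1) (hP s hs.2.1 hs.2.2.1) (hP t ht.2.1 ht.2.2.1)
        ((Lp.memLp (P s)).integrable one_le_two) ((Lp.memLp (P t)).integrable one_le_two)
        hs.2.2.2 ht.2.2.2)
  refine ⟨S, fun t ht => hS₁T (hS ht).1.1, hSae, fun s hs t ht => ?_⟩
  have := hSinc s hs t ht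
  simpa only [Fin.sum_univ_two, Matrix.cons_val_zero, Matrix.cons_val_one] using this

end AllenCahn

end

/-! ### The relative energy inequality -/

theorem mainTheorem4 {d : ℕ} (hd : d = 1 ∨ d = 2 ∨ d = 3)
    (Ω : Set (AllenCahn.Space d)) (hΩ : AllenCahn.IsRegularDomain Ω)
    (T : ℝ) (hT : 0 < T) (γ : ℝ) (hγ : 0 < γ)
    (b : ℝ → ℝ) (b₁ b₂ b₃ b₄ : ℝ) (hb : AllenCahn.MobilityAssumption b b₁ b₂ b₃ b₄)
    (f : ℝ → ℝ) (f₁ : ℝ) (f₂ f₃ : ℕ → ℝ) (hf : AllenCahn.PotentialAssumption f f₁ f₂ f₃)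
    (φ : ℝ → AllenCahn.H1 Ω) (φt μ : ℝ → AllenCahn.L2 Ω)
    (hφ : AllenCahn.IsWeakSolution Ω T γ b f φ φt μ)
    (φh φht : ℝ → AllenCahn.H2 Ω) (μh : ℝ → AllenCahn.LInf Ω) (r₁ r₂ : ℝ → AllenCahn.L2 Ω)
    (hφh : AllenCahn.IsPerturbedSolution Ω T γ b f φh φht μh r₁ r₂) :
    (∀ᵐ t ∂(AllenCahn.timeMeasure T),
      MemLp ((φh t).toL2) ∞ (volume.restrict Ω) ∧ MemLp ((φht t).toL2) ∞ (volume.restrict Ω)) ∧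
    ∃ e : ℝ → ℝ, AbsolutelyContinuousOnInterval e 0 T ∧
      (∀ᵐ t ∂(AllenCahn.timeMeasure T), e t = AllenCahn.relEnergy γ f (φ t) (φh t).toH1) ∧
      ∀ᵐ t ∂(AllenCahn.timeMeasure T), DifferentiableAt ℝ e t ∧
        ∀ C₁ C₂ C₃ C₄ : ℝ,
          C₁ = f₂ 3 + f₃ 3 * (1 + AllenCahn.supNorm (φh t).toL2) →
          C₂ = 1 / 2 + 3 / b₁ →
          C₃ = 1 + 3 * b₂ →
          (C₄ = b₃ ^ 2 + 6 * b₃ ^ 2 / b₁ ∨ (b₁ ≤ 10 ∧ C₄ = b₃ + 6 * b₃ ^ 2 / b₁ ^ 2)) →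
          deriv e t + 1 / 2 * AllenCahn.relDissipation b (φ t).toL2 (μ t) (μh t) ≤
            (C₁ / γ * AllenCahn.supNorm (φht t).toL2 + C₄ * ‖μh t‖ ^ 2)
                * ‖(φ t).toL2 - (φh t).toL2‖ ^ 2
              + C₂ * ‖r₁ t‖ ^ 2 + C₃ * ‖r₂ t‖ ^ 2 := by
  have hd3 : d ≤ 3 := by omega
  have : MeasureTheory.IsFiniteMeasure (MeasureTheory.volume.restrict Ω) :=
    ⟨by simpa using hΩ.isBounded.measure_lt_top⟩
  obtain ⟨Cs, -, hsob⟩ := AllenCahn.exists_sobolev_bound hd3 hΩ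
  have hbdd : ∀ u : AllenCahn.H2 Ω, MemLp u.toL2 ∞ (volume.restrict Ω) := fun u =>
    memLp_top_of_bound (Lp.aestronglyMeasurable _) _ (hsob u)
  refine ⟨Filter.Eventually.of_forall fun t => ⟨hbdd _, hbdd _⟩, ?_⟩
  obtain ⟨R, hR, hint, S, hST, hS, hinc⟩ :=
    AllenCahn.exists_relEnergy_increment hd3 hΩ hγ hb hf.contDiff hφ hφh
  -- The good set has full measure in a nonempty interval; any of its points serves as the base of
  -- the primitive.
  obtain ⟨s, hs⟩ : S.Nonempty := by
    have h0 : (volume.restrict (Ioo 0 T)) ≠ 0 := by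
      rw [Ne, Measure.restrict_eq_zero, Real.volume_Ioo]
      simpa using hT
    have : (MeasureTheory.ae (volume.restrict (Ioo 0 T))).NeBot := MeasureTheory.ae_neBot.2 h0
    exact hS.exists
  have hii : IntervalIntegrable (fun t => inner ℝ (φt t - (φht t).toL2)
      (μ t - AllenCahn.inclL2 (μh t) + r₂ t) + inner ℝ (φht t).toL2 ((1 / γ) • R t))
      volume 0 T := by
    rw [intervalIntegrable_iff_integrableOn_Ioo_of_le hT.le]
    exact hint
  have hsT : s ∈ uIcc 0 T := by
    rw [uIcc_of_le hT.le]
    exact Ioo_subset_Icc_self (hST hs)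
  -- The representative is the primitive of the rate, normalised to the relative energy at `s`.
  refine ⟨fun t => AllenCahn.relEnergy γ f (φ s) (φh s).toH1 + ∫ x in s..t,
      (inner ℝ (φt x - (φht x).toL2) (μ x - AllenCahn.inclL2 (μh x) + r₂ x)
        + inner ℝ (φht x).toL2 ((1 / γ) • R x)), ?_, ?_, ?_⟩
  · exact (LipschitzWith.const _).lipschitzOnWith.absolutelyContinuousOnInterval.fun_add
      (hii.absolutelyContinuousOnInterval_intervalIntegral hsT)
  · filter_upwards [show ∀ᵐ t ∂(AllenCahn.timeMeasure T), t ∈ S from hS] with t ht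
    rw [← hinc s hs t ht]
    ring
  · have hder := (ae_restrict_iff' (s := Ioo 0 T) measurableSet_Ioo).2
      (hii.ae_hasDerivAt_integral.mono fun t ht (ht' : t ∈ Ioo 0 T) =>
        ht (by rw [uIcc_of_le hT.le]; exact Ioo_subset_Icc_self ht') s hsT)
    filter_upwards [show ∀ᵐ t ∂(AllenCahn.timeMeasure T), _ from hder, hR, hφ.range, hφ.eq_phi,
      hφh.eq_phi] with t h1 h2 h3 h4 h5
    have h1' := h1.const_add (AllenCahn.relEnergy γ f (φ s) (φh s).toH1)
    refine ⟨h1'.differentiableAt, fun C₁ C₂ C₃ C₄ hC₁ hC₂ hC₃ hC₄ => ?_⟩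
    rw [h1'.deriv]
    exact AllenCahn.rate_le hγ hb hf h3 (hbdd _) (hbdd _) rfl h2 h4 h5 hC₁ hC₂ hC₃ hC₄
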